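/- A finite partial monitoring game is given by positive integers $k,d$, a finite set $\Sigma$, a loss matrix $\mathcal L\in[0,1]^{k\times d}$ and a signal matrix $\Phi\in\Sigma^{k\times d}$. Let $\mathcal P\subset\mathbb R^k$ and $\mathcal D\subset\mathbb R^d$ be the probability simplices, and let $m=\max_{a\in[k]}|\{\Phi_{ax}:x\in[d]\}|$. The cell of an action $a\in[k]$ is $C_a=\{\nu\in\mathcal D: (\mathcal L\nu)_a\le(\mathcal L\nu)_b\text{ for all }b\in[k]\}$; dimensions are those of affine hulls. Let $\Pi=\{a:\dim C_a=d-1\}$ be the set of Pareto optimal actions. The game is non-degenerate if there is no action $a$ with $C_a\ne\emptyset$ and $\dim C_a\le d-2$. Actions $a,b\in\Pi$ are neighbours if $\dim(C_a\cap C_b)=d-2$. A non-degenerate game is locally observable if for all neighbours $a,b$ there is $w:[k]\times\Sigma\to\mathbb R$ such that $\mathcal L_{ax}-\mathcal L_{bx}=\sum_{c=1}^k w(c,\Phi_{cx})$ for all $x\in[d]$, and $w(c,\sigma)=0$ for all $c\notin\{a,b\}$ and all $\sigma\in\Sigma$. For $q\in\mathcal P$ and $z\in\mathbb R^k$ let $\Psi_q(z)=\sum_{b}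 q_b(e^{-z_b}+z_b-1)$. For $G:[k]\times\Sigma\to\mathbb R^k$ and $x\in[d]$ let \[\operatorname{bias}_q(G;x)=\sum_{b=1}^k q_b\Big(\mathcal L_{bx}-\sum_{a=1}^k G(a,\Phi_{ax})_b\Big)+\max_{c\in\Pi}\Big(\sum_{a=1}^k G(a,\Phi_{ax})_c-\mathcal L_{cx}\Big).\] For $\eta>0$ let \[\operatorname{opt}_q(\eta)=\inf_{G:[k]\times\Sigma\to\mathbb R^k,\;p\in\mathcal P}\ \max_{x\in[d]}\left[\frac{\sum_{a}(p_a-q_a)\mathcal L_{ax}+\operatorname{bias}_q(G;x)}{\eta}+\frac1{\eta^2}\sum_{a=1}^k p_a\Psi_q\!\left(\frac{\eta\,G(a,\Phi_{ax})}{p_a}\right)\right],\] where for $p_a=0$ the expression $p_a\Psi_q(z/p_a)$ stands for its limit in $(-\infty,+\infty]$ as $p_a\downarrow0$, and let $\operatorname{opt}_*(\eta)=\sup_{q\in\mathcal P}\operatorname{opt}_q(\eta)$. The minimax regret over $n$ rounds is \[\mathfrak R_n^*=\inf_\pi\ \sup_{(x_t)\in[d]^n}\ \mathbb E\Big[\max_{a\in[k]}\sum_{t=1}^n(\mathcal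 L_{A_tx_t}-\mathcal L_{ax_t})\Big],\] where the infimum is over policies $\pi$, that is, maps from finite sequences in $[k]\times\Sigma$ to $\mathcal P$, and $A_t$ is sampled from $\pi$ at the history $(A_s,\Phi_{A_sx_s})_{s<t}$. Suppose that the game is non-degenerate and locally observable, and that no two rows of $\mathcal L$ are equal. Then \[\operatorname{opt}_*(\eta)\le 3m^2k^3\qquad\text{for all }0<\eta\le\frac1{2mk^2},\] and consequently \[\mathfrak R_n^*\le 2k^{3/2}m\sqrt{3n\log k}\qquad\text{for all }n\ge0.\] -/

import Mathlib

noncomputable section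

open scoped Classical in
/-- Dimension of a set: the dimension of its affine hull, with dimension `-1` for the empty set. -/
def affDim {d : ℕ} (C : Set (Fin d → ℝ)) : ℤ :=
  if C = ∅ then -1 else (Module.finrank ℝ (vectorSpan ℝ C) : ℤ)

/-- A finite partial monitoring game with `k` actions, `d` outcomes and signals in `S`:
a signal matrix and a loss matrix with entries in `[0, 1]`. -/
structure PMGame (k d : ℕ) (S : Type*) where
  signal : Fin k → Fin d → S
  loss : Fin k → Fin d → ℝ
  loss_mem : ∀ a x, loss a x ∈ Set.Icc (0 : ℝ) 1

namespace PMGame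

variable {k d : ℕ} {S : Type*} (𝒢 : PMGame k d S)

/-- The expected loss of action `a` when the outcome has law `ν`. -/
def expLoss (a : Fin k) (ν : Fin d → ℝ) : ℝ := ∑ x, 𝒢.loss a x * ν x

/-- The cell of action `a`: the laws on outcomes for which `a` is optimal. -/
def cell (a : Fin k) : Set (Fin d → ℝ) :=
  {ν | ν ∈ stdSimplex ℝ (Fin d) ∧ ∀ b, 𝒢.expLoss a ν ≤ 𝒢.expLoss b ν}

/-- The set of Pareto optimal actions. -/
def pareto : Set (Fin k) := {a | affDim (𝒢.cell a) = (d : ℤ) - 1}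

/-- Degenerate actions: the cell is nonempty, but of dimension at most `d - 2`. -/
def IsDegenerateAction (a : Fin k) : Prop :=
  (𝒢.cell a).Nonempty ∧ affDim (𝒢.cell a) ≤ (d : ℤ) - 2

/-- A game is non-degenerate if it has no degenerate actions. -/
def NonDegenerate : Prop := ∀ a, ¬ 𝒢.IsDegenerateAction a

/-- No two distinct actions have the same losses. -/
def NoDuplicates : Prop := ∀ a b, a ≠ b → 𝒢.loss a ≠ 𝒢.loss b

/-- Pareto optimal actions are neighbours if their cells meet in dimension `d - 2`. -/
def Neighbours (a b : Fin k) : Prop :=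
  a ∈ 𝒢.pareto ∧ b ∈ 𝒢.pareto ∧ affDim (𝒢.cell a ∩ 𝒢.cell b) = (d : ℤ) - 2

/-- Local observability (of non-degenerate games): the loss difference of any two neighbours can
be estimated from the signals of these two actions only. -/
def LocallyObservable : Prop :=
  ∀ a b, 𝒢.Neighbours a b → ∃ w : Fin k → S → ℝ,
    (∀ x, 𝒢.loss a x - 𝒢.loss b x = ∑ c, w c (𝒢.signal c x)) ∧
    (∀ c, c ≠ a → c ≠ b → ∀ σ, w c σ = 0)

/-- The maximum over the actions of the number of different signals of an action. -/
def maxSignals : ℕ := Finset.univ.sup fun a : Fin k => (Set.range (𝒢.signal a)).ncard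

/-- The stability term `⟨q, exp (-z) + z - 1⟩` of exponential weights. -/
def stab (q z : Fin k → ℝ) : ℝ := ∑ b, q b * (Real.exp (-z b) + z b - 1)

/-- The perspective `p * stab q (z / p)`. For `p = 0` it is extended by its limit as `p` decreases
to `0` (its lower semicontinuous convex extension): a coordinate with `z b ≥ 0` contributes
`q b * z b`, a coordinate with `z b < 0` contributes `+∞` (or `0`, if `q b = 0`). -/
def perspStab (q : Fin k → ℝ) (p : ℝ) (z : Fin k → ℝ) : EReal :=
  if 0 < p then ((p * stab q (fun b => z b / p) : ℝ) : EReal)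
  else ∑ b, (q b : EReal) * (if 0 ≤ z b then (z b : EReal) else ⊤)

/-- The bias of the estimation function `G` at the outcome `x`. The supremum is the maximum over
the (finite, nonempty) set of Pareto optimal actions. -/
def bias (q : Fin k → ℝ) (G : Fin k → S → Fin k → ℝ) (x : Fin d) : ℝ :=
  (∑ b, q b * (𝒢.loss b x - ∑ a, G a (𝒢.signal a x) b)) +
    ⨆ c : 𝒢.pareto, ((∑ a, G a (𝒢.signal a x) c) - 𝒢.loss c x)

/-- The objective of exploration by optimisation, before the maximum over outcomes. -/
def objective (η : ℝ) (q : Fin k → ℝ) (G : Fin k → S → Fin k → ℝ) (p : Fin k → ℝ)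
    (x : Fin d) : EReal :=
  ((((∑ a, (p a - q a) * 𝒢.loss a x) + 𝒢.bias q G x) / η : ℝ) : EReal) +
    ((1 / η ^ 2 : ℝ) : EReal) *
      ∑ a, perspStab q (p a) (fun b => η * G a (𝒢.signal a x) b)

/-- The value of the optimisation problem at the distribution `q`. -/
def optAt (η : ℝ) (q : Fin k → ℝ) : EReal :=
  ⨅ (G : Fin k → S → Fin k → ℝ) (p ∈ stdSimplex ℝ (Fin k)), ⨆ x, 𝒢.objective η q G p x

/-- The worst case over `q` of the value of the optimisation problem. -/
def optStar (η : ℝ) : EReal := ⨆ q ∈ stdSimplex ℝ (Fin k), 𝒢.optAt η q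

/-- A policy maps histories of actions and signals to distributions over the actions. -/
structure Policy (k : ℕ) (S : Type*) where
  prob : List (Fin k × S) → Fin k → ℝ
  prob_mem : ∀ h, prob h ∈ stdSimplex ℝ (Fin k)

/-- The history before round `t` when actions `A` are played against outcomes `x`. -/
def history {n : ℕ} (A : Fin n → Fin k) (x : Fin n → Fin d) (t : Fin n) : List (Fin k × S) :=
  List.ofFn fun s : Fin t =>
    (A (s.castLE t.isLt.le), 𝒢.signal (A (s.castLE t.isLt.le)) (x (s.castLE t.isLt.le)))

/-- The regret of the actions `A` against the outcomes `x`, relative to the best fixed action. -/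
def regret {n : ℕ} (A : Fin n → Fin k) (x : Fin n → Fin d) : ℝ :=
  ⨆ a : Fin k, ∑ t, (𝒢.loss (A t) (x t) - 𝒢.loss a (x t))

/-- The expected regret of a policy against a fixed sequence of outcomes; the product is the
probability that the policy plays the actions `A`. -/
def expRegret (π : Policy k S) {n : ℕ} (x : Fin n → Fin d) : ℝ :=
  ∑ A : Fin n → Fin k, (∏ t, π.prob (𝒢.history A x t) (A t)) * 𝒢.regret A x

/-- The minimax regret over `n` rounds. -/
def minimaxRegret (n : ℕ) : EReal :=
  ⨅ π : Policy k S, ⨆ x : Fin n → Fin d, (𝒢.expRegret π x : EReal)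

end PMGame

end

/-! Fix `q`. On designs (estimators together with sampling distributions of full support) the
objective is finite and convex, because its stability term is a perspective. By the minimax theorem
`exists_forall_lt_of_forall_stdSimplex` the worst outcome may be replaced by a known law `ν`, and
the design may depend on `ν`.

For known `ν` the geometry of the cells provides a root `r` and, from every other Pareto optimal
action, a chain of neighbours of decreasing rank that ends in `r` and never increases the expected
loss (`exists_rank`). Telescoping the local estimators along the chain of `b` estimates the loss of
`b` minus that of `r` from the signals of the chain alone. Each local estimator can be bounded by
`m` and each action meets at most two links, so the sum is bounded by `2m`. Sampling spreads the
mass `q b` uniformly over the chain of `b`, which does not increase the expected loss at `ν`, yet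
plays every action of the chain with probability at least `q b / k`. A little uniform exploration
keeps the arguments of the exponential in `[-1, 1]`, where the stability term is at most quadratic
(`exists_design_of_estimator`).

For the regret, exponential weights are run on the importance weighted estimates. The regret plus a
log-sum-exp potential grows in expectation by at most `η` times the value of the design per round.
Tuning `η` gives the bound, and the range of small `n`, where this `η` may be too large, is covered
by the trivial bound `n`. -/

open Filter Topology MeasureTheory

/-! ### Generic points of the simplex, spans and affine dimension. -/

/-- A positive point of the simplex at which none of finitely many nonzero linear forms vanishes. -/
theorem exists_pos_mem_stdSimplex_dotProduct_ne_zero {d : ℕ} (hd : 0 < d) {ι : Type*} [Fintype ι]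
    (g : ι → Fin d → ℝ) :
    ∃ μ ∈ stdSimplex ℝ (Fin d), (∀ x, 0 < μ x) ∧ ∀ i, g i ≠ 0 → g i ⬝ᵥ μ ≠ 0 := by
  classical
  -- On the moment curve `x ↦ t ^ x` a nonzero form becomes a nonzero polynomial in `t`. Any
  -- positive `t` outside the finitely many roots works.
  let P : ι → Polynomial ℝ := fun i => ∑ x : Fin d, Polynomial.monomial (x : ℕ) (g i x)
  have hP : ∀ i, g i ≠ 0 → P i ≠ 0 := by
    intro i hi h0
    obtain ⟨x, hx⟩ := Function.ne_iff.1 hi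
    apply hx
    have := congrArg (fun p => Polynomial.coeff p (x : ℕ)) h0
    simpa [P, Polynomial.finsetSum_coeff, Polynomial.coeff_monomial, Fin.val_inj] using this
  obtain ⟨t, ht, htn⟩ := (Set.Ioi_infinite (0 : ℝ)).exists_notMem_finset
    (Finset.univ.biUnion fun i => (P i).roots.toFinset)
  have ht : 0 < t := ht
  have : Nonempty (Fin d) := ⟨⟨0, hd⟩⟩
  have hs : 0 < ∑ x : Fin d, t ^ (x : ℕ) :=
    Finset.sum_pos (fun x _ => pow_pos ht _) Finset.univ_nonempty
  refine ⟨fun x => t ^ (x : ℕ) / ∑ y : Fin d, t ^ (y : ℕ), ⟨fun x => by positivity, ?_⟩,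
    fun x => by positivity, fun i hi h0 => htn ?_⟩
  · rw [← Finset.sum_div, div_self hs.ne']
  · have h1 : g i ⬝ᵥ (fun x : Fin d => t ^ (x : ℕ) / ∑ y : Fin d, t ^ (y : ℕ))
        = (P i).eval t / ∑ y : Fin d, t ^ (y : ℕ) := by
      simp [dotProduct, P, Polynomial.eval_finsetSum, Finset.sum_div, mul_div_assoc]
    rw [h1, div_eq_zero_iff] at h0
    simp only [Finset.mem_biUnion, Finset.mem_univ, true_and, Multiset.mem_toFinset]
    exact ⟨i, (Polynomial.mem_roots (hP i hi)).2 (h0.resolve_right hs.ne')⟩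

/-- Positive points at which none of finitely many nonzero linear forms vanishes are dense in the
simplex. -/
theorem exists_mem_nhds_dotProduct_ne_zero {d : ℕ} (hd : 0 < d) {ι : Type*} [Fintype ι]
    (g : ι → Fin d → ℝ) {μ₀ : Fin d → ℝ} (hμ₀ : μ₀ ∈ stdSimplex ℝ (Fin d))
    {N : Set (Fin d → ℝ)} (hN : N ∈ 𝓝 μ₀) :
    ∃ μ ∈ N, μ ∈ stdSimplex ℝ (Fin d) ∧ (∀ x, 0 < μ x) ∧ ∀ i, g i ≠ 0 → g i ⬝ᵥ μ ≠ 0 := by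
  obtain ⟨μ₁, hμ₁, hpos, hg⟩ := exists_pos_mem_stdSimplex_dotProduct_ne_zero hd g
  have hcont : Tendsto (fun ε : ℝ => (1 - ε) • μ₀ + ε • μ₁) (𝓝[>] 0) (𝓝 μ₀) := by
    have : Continuous fun ε : ℝ => (1 - ε) • μ₀ + ε • μ₁ := by fun_prop
    simpa using (this.tendsto 0).mono_left nhdsWithin_le_nhds
  have h1 : ∀ᶠ ε : ℝ in 𝓝[>] 0, ε < 1 :=
    nhdsWithin_le_nhds (Iio_mem_nhds one_pos)
  have h0 : ∀ᶠ ε : ℝ in 𝓝[>] 0, 0 < ε := self_mem_nhdsWithin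
  have hne : ∀ᶠ ε : ℝ in 𝓝[>] 0, ∀ i, g i ≠ 0 → g i ⬝ᵥ ((1 - ε) • μ₀ + ε • μ₁) ≠ 0 := by
    rw [eventually_all]
    intro i
    by_cases hi : g i = 0
    · simp [hi]
    -- A form vanishing at `μ₀` takes the value `ε` times its nonzero value at `μ₁`. Any other form
    -- stays nonzero near `μ₀` by continuity.
    by_cases hz : g i ⬝ᵥ μ₀ = 0
    · filter_upwards [h0] with ε hε _
      simp only [dotProduct_add, dotProduct_smul, hz, smul_eq_mul, mul_zero, zero_add]
      exact mul_ne_zero hε.ne' (hg i hi)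
    · have hc : Tendsto (fun ε : ℝ => g i ⬝ᵥ ((1 - ε) • μ₀ + ε • μ₁)) (𝓝[>] 0) (𝓝 (g i ⬝ᵥ μ₀)) := by
        have : Continuous fun μ : Fin d → ℝ => g i ⬝ᵥ μ := by
          unfold dotProduct; fun_prop
        exact (this.tendsto _).comp hcont
      filter_upwards [hc.eventually_ne hz] with ε hε _ using hε
  obtain ⟨ε, hεN, hε1, hε0, hε⟩ := ((hcont.eventually hN).and (h1.and (h0.and hne))).exists
  refine ⟨_, hεN, convex_stdSimplex ℝ _ hμ₀ hμ₁ (by linarith) hε0.le (by ring), fun x => ?_, hε⟩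
  have := mul_pos hε0 (hpos x)
  have : 0 ≤ (1 - ε) * μ₀ x := mul_nonneg (by linarith) (hμ₀.1 x)
  simp only [Pi.add_apply, Pi.smul_apply, smul_eq_mul]
  linarith

/-- For subsets of the simplex, the affine dimension is one less than the linear dimension. -/
theorem affDim_eq_finrank_span_sub_one {d : ℕ} {C : Set (Fin d → ℝ)}
    (hC : C ⊆ stdSimplex ℝ (Fin d)) :
    affDim C = (Module.finrank ℝ (Submodule.span ℝ C) : ℤ) - 1 := by
  unfold affDim
  split_ifs with h
  · subst h
    rw [Submodule.span_empty, finrank_bot]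
    norm_num
  · obtain ⟨p, hp⟩ := Set.nonempty_iff_ne_empty.2 h
    have hsum : ∀ v ∈ vectorSpan ℝ C, ∑ x, v x = 0 := by
      intro v hv
      have hle : vectorSpan ℝ C ≤ LinearMap.ker (∑ x : Fin d, LinearMap.proj (R := ℝ) (φ := fun _ : Fin d => ℝ) x) := by
        rw [vectorSpan_def, Submodule.span_le]
        rintro _ ⟨y, hy, z, hz, rfl⟩
        simp [(hC hy).2, (hC hz).2]
      simpa using hle hv
    have hspan : Submodule.span ℝ C = vectorSpan ℝ C ⊔ Submodule.span ℝ {p} := by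
      apply le_antisymm
      · rw [Submodule.span_le]
        intro y hy
        have : y = (y - p) + p := by simp
        rw [this]
        exact Submodule.add_mem_sup (vsub_mem_vectorSpan ℝ hy hp)
          (Submodule.mem_span_singleton_self p)
      · refine sup_le ?_ (Submodule.span_mono (by simpa using hp))
        rw [vectorSpan_def, Submodule.span_le]
        rintro _ ⟨y, hy, z, hz, rfl⟩
        exact Submodule.sub_mem _ (Submodule.subset_span hy) (Submodule.subset_span hz)
    -- The sum of coordinates vanishes on the direction space but equals `1` at `p`, so `p` adds
    -- exactly one dimension.
    have hinf : vectorSpan ℝ C ⊓ Submodule.span ℝ {p} = ⊥ := by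
      rw [eq_bot_iff]
      rintro v ⟨hv, hv'⟩
      obtain ⟨c, rfl⟩ := Submodule.mem_span_singleton.1 hv'
      have := hsum _ hv
      simp only [Pi.smul_apply, smul_eq_mul, ← Finset.mul_sum, (hC hp).2, mul_one] at this
      simp [this]
    have hp0 : p ≠ 0 := by
      rintro rfl
      simpa using (hC hp).2
    have := Submodule.finrank_sup_add_finrank_inf_eq (vectorSpan ℝ C) (Submodule.span ℝ {p})
    rw [hinf, ← hspan, finrank_span_singleton hp0, finrank_bot] at this
    omega

theorem mem_span_of_inv_sum_smul_mem {d : ℕ} {C : Set (Fin d → ℝ)} {y : Fin d → ℝ}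
    (hy : 0 < ∑ x, y x) (h : (∑ x, y x)⁻¹ • y ∈ C) : y ∈ Submodule.span ℝ C := by
  have := Submodule.smul_mem _ (∑ x, y x) (Submodule.subset_span (R := ℝ) h)
  rwa [smul_smul, mul_inv_cancel₀ hy.ne', one_smul] at this

theorem inv_sum_smul_mem_stdSimplex {d : ℕ} {y : Fin d → ℝ} (hy : 0 < ∑ x, y x)
    (h : ∀ x, 0 ≤ y x) : (∑ x, y x)⁻¹ • y ∈ stdSimplex ℝ (Fin d) := by
  refine ⟨fun x => mul_nonneg (inv_nonneg.2 hy.le) (h x), ?_⟩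
  simp only [Pi.smul_apply, smul_eq_mul, ← Finset.mul_sum]
  exact inv_mul_cancel₀ hy.ne'

/-- A subspace is contained in a span as soon as the span contains, at some point `ξ`, small
displacements in the directions of the subspace. -/
theorem mem_span_of_eventually {d : ℕ} {C : Set (Fin d → ℝ)} {ξ h : Fin d → ℝ}
    (hξ : ξ ∈ Submodule.span ℝ C)
    (hh : ∀ᶠ ε : ℝ in 𝓝[>] 0, ξ + ε • h ∈ Submodule.span ℝ C) : h ∈ Submodule.span ℝ C := by
  obtain ⟨ε, hε, hε0⟩ := (hh.and self_mem_nhdsWithin).exists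
  have hε0 : 0 < ε := hε0
  have h1 := Submodule.smul_mem _ ε⁻¹ (Submodule.sub_mem _ hε hξ)
  rwa [add_sub_cancel_left, smul_smul, inv_mul_cancel₀ hε0.ne', one_smul] at h1

theorem eventually_dotProduct_add_smul_pos {d : ℕ} {u ξ : Fin d → ℝ} (h : Fin d → ℝ)
    (hu : 0 < u ⬝ᵥ ξ) : ∀ᶠ ε : ℝ in 𝓝[>] 0, 0 < u ⬝ᵥ (ξ + ε • h) := by
  have hc : Continuous fun ε : ℝ => u ⬝ᵥ (ξ + ε • h) := by unfold dotProduct; fun_prop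
  refine nhdsWithin_le_nhds (hc.continuousAt.eventually (lt_mem_nhds ?_))
  simpa using hu

theorem eventually_add_smul_pos {d : ℕ} {ξ : Fin d → ℝ} (h : Fin d → ℝ)
    (hξ : ∀ x, 0 < ξ x) : ∀ᶠ ε : ℝ in 𝓝[>] 0, ∀ x, 0 < (ξ + ε • h) x := by
  rw [eventually_all]
  intro x
  simpa using eventually_dotProduct_add_smul_pos (u := Pi.single x 1) h (by simpa using hξ x)

/-! ### Geometry of the cells and of their neighbourhood relation. -/

namespace PMGame

variable {k d : ℕ} {S : Type*} (𝒢 : PMGame k d S)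

theorem expLoss_eq_dotProduct (a : Fin k) (ν : Fin d → ℝ) : 𝒢.expLoss a ν = 𝒢.loss a ⬝ᵥ ν := rfl

theorem cell_subset_stdSimplex (a : Fin k) : 𝒢.cell a ⊆ stdSimplex ℝ (Fin d) := fun _ h => h.1

/-- Replaces affine dimension by linear spans, so that cells can be handled as cones and positive
vectors need no normalisation. -/
theorem mem_pareto_iff_span_eq_top {a : Fin k} :
    a ∈ 𝒢.pareto ↔ Submodule.span ℝ (𝒢.cell a) = ⊤ := by
  have : a ∈ 𝒢.pareto ↔ affDim (𝒢.cell a) = (d : ℤ) - 1 := Iff.rfl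
  rw [this, affDim_eq_finrank_span_sub_one (𝒢.cell_subset_stdSimplex a)]
  constructor
  · intro h
    apply Submodule.eq_top_of_finrank_eq
    rw [Module.finrank_fin_fun]
    omega
  · intro h
    rw [h, finrank_top, Module.finrank_fin_fun]

theorem inv_sum_smul_mem_cell {a : Fin k} {y : Fin d → ℝ} (hs : 0 < ∑ x, y x)
    (hy : ∀ x, 0 ≤ y x) (h : ∀ c, 0 ≤ (𝒢.loss c - 𝒢.loss a) ⬝ᵥ y) :
    (∑ x, y x)⁻¹ • y ∈ 𝒢.cell a := by
  refine ⟨inv_sum_smul_mem_stdSimplex hs hy, fun c => ?_⟩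
  rw [expLoss_eq_dotProduct, expLoss_eq_dotProduct, dotProduct_smul, dotProduct_smul]
  have := h c
  rw [sub_dotProduct] at this
  exact mul_le_mul_of_nonneg_left (by linarith) (inv_nonneg.2 hs.le)

/-- An action which is the only optimal one at some positive point is Pareto optimal. -/
theorem mem_pareto_of_forall_lt (hd : 0 < d) {a : Fin k} {ξ : Fin d → ℝ} (hξ : ∀ x, 0 < ξ x)
    (h : ∀ c, c ≠ a → 𝒢.expLoss a ξ < 𝒢.expLoss c ξ) : a ∈ 𝒢.pareto := by
  have : Nonempty (Fin d) := ⟨⟨0, hd⟩⟩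
  rw [mem_pareto_iff_span_eq_top, eq_top_iff]
  have hu : ∀ c, c ≠ a → 0 < (𝒢.loss c - 𝒢.loss a) ⬝ᵥ ξ := fun c hc => by
    rw [sub_dotProduct]; exact sub_pos.2 (h c hc)
  have key : ∀ y : Fin d → ℝ, (∀ x, 0 < y x) → (∀ c, c ≠ a → 0 < (𝒢.loss c - 𝒢.loss a) ⬝ᵥ y) →
      y ∈ Submodule.span ℝ (𝒢.cell a) := fun y hy hc => by
    have hs : 0 < ∑ x, y x := Finset.sum_pos (fun x _ => hy x) Finset.univ_nonempty
    refine mem_span_of_inv_sum_smul_mem hs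
      (𝒢.inv_sum_smul_mem_cell hs (fun x => (hy x).le) fun c => ?_)
    rcases eq_or_ne c a with rfl | hca
    · simp
    · exact (hc c hca).le
  intro y _
  refine mem_span_of_eventually (key ξ hξ hu) ?_
  have h2 : ∀ᶠ ε : ℝ in 𝓝[>] 0, ∀ c, c ≠ a → 0 < (𝒢.loss c - 𝒢.loss a) ⬝ᵥ (ξ + ε • y) := by
    rw [eventually_all]
    intro c
    by_cases hc : c = a
    · simp [hc]
    · filter_upwards [eventually_dotProduct_add_smul_pos y (hu c hc)] with ε hε _ using hε
  filter_upwards [eventually_add_smul_pos y hξ, h2] with ε h1 h2 using key _ h1 h2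

/-- The cell of a Pareto optimal action has a point at which no other action is optimal. -/
theorem exists_mem_cell_forall_pos (hd : 0 < d) (hdup : 𝒢.NoDuplicates) {b : Fin k}
    (hb : b ∈ 𝒢.pareto) :
    ∃ μ ∈ stdSimplex ℝ (Fin d), ∀ a, a ≠ b → 0 < (𝒢.loss a - 𝒢.loss b) ⬝ᵥ μ := by
  rw [mem_pareto_iff_span_eq_top] at hb
  have hnn : ∀ a, ∀ μ ∈ 𝒢.cell b, 0 ≤ (𝒢.loss a - 𝒢.loss b) ⬝ᵥ μ := fun a μ hμ => by
    rw [sub_dotProduct]; exact sub_nonneg.2 (hμ.2 a)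
  -- Otherwise the loss difference would vanish on the cell, hence on its span, which is everything.
  -- Averaging the points found for the different `a` serves all of them at once.
  have hex : ∀ a, ∃ μ ∈ 𝒢.cell b, a ≠ b → 0 < (𝒢.loss a - 𝒢.loss b) ⬝ᵥ μ := by
    intro a
    by_contra! hcon
    have hle : Submodule.span ℝ (𝒢.cell b) ≤
        LinearMap.ker (dotProductBilin ℝ ℝ (𝒢.loss a - 𝒢.loss b)) := by
      rw [Submodule.span_le]
      intro μ hμ
      exact le_antisymm (hcon μ hμ).2 (hnn a μ hμ)
    rw [hb] at hle
    have hne : (𝒢.cell b).Nonempty := by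
      by_contra hemp
      rw [Set.not_nonempty_iff_eq_empty] at hemp
      rw [hemp, Submodule.span_empty] at hb
      have h1 : (Pi.single ⟨0, hd⟩ 1 : Fin d → ℝ) ∈ (⊥ : Submodule ℝ (Fin d → ℝ)) := by
        rw [hb]; trivial
      simp at h1
    obtain ⟨μ, hμ⟩ := hne
    refine hdup a b (hcon μ hμ).1 (sub_eq_zero.1 ?_)
    have := hle (x := 𝒢.loss a - 𝒢.loss b) trivial
    exact dotProduct_self_eq_zero.1 this
  choose μ hμ hpos using hex
  have hk : (0 : ℝ) < k := by exact_mod_cast b.pos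
  refine ⟨∑ a, (k : ℝ)⁻¹ • μ a, ?_, fun a ha => ?_⟩
  · refine (convex_stdSimplex ℝ (Fin d)).sum_mem (fun _ _ => by positivity) ?_
      fun a _ => (hμ a).1
    simp [hk.ne']
  · rw [dotProduct_sum]
    refine Finset.sum_pos' (fun c _ => ?_) ⟨a, Finset.mem_univ a, ?_⟩
    · rw [dotProduct_smul]
      exact mul_nonneg (by positivity) (hnn a _ (hμ c))
    · rw [dotProduct_smul]
      exact mul_pos (by positivity) (hpos a ha)

theorem continuous_dotProduct_right (u : Fin d → ℝ) : Continuous fun μ : Fin d → ℝ => u ⬝ᵥ μ := by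
  unfold dotProduct; fun_prop

end PMGame

namespace PMGame

variable {k d : ℕ} {S : Type*} (𝒢 : PMGame k d S)

/-- If the positive point `ξ` lies on the wall between `a` and `b`, and all actions which are
optimal at `ξ` have losses on the segment between those of `a` and `b`, then `a` is a neighbour of
`b`. -/
theorem neighbours_of_wall (hd : 0 < d) {a b : Fin k} (hb : b ∈ 𝒢.pareto) {ξ : Fin d → ℝ}
    (hξ : ∀ x, 0 < ξ x) (hab : 𝒢.loss a ≠ 𝒢.loss b) (ha : (𝒢.loss a - 𝒢.loss b) ⬝ᵥ ξ = 0)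
    (hc : ∀ c, 0 < (𝒢.loss c - 𝒢.loss b) ⬝ᵥ ξ ∨
      ∃ s : ℝ, 0 ≤ s ∧ s ≤ 1 ∧ 𝒢.loss c - 𝒢.loss b = s • (𝒢.loss a - 𝒢.loss b)) :
    𝒢.Neighbours b a := by
  have : Nonempty (Fin d) := ⟨⟨0, hd⟩⟩
  set u : Fin k → Fin d → ℝ := fun c => 𝒢.loss c - 𝒢.loss b with hu
  have hua : ∀ c, 𝒢.loss c - 𝒢.loss a = u c - u a := fun c => by simp [hu]
  have hsum : ∀ y : Fin d → ℝ, (∀ x, 0 < y x) → 0 < ∑ x, y x := fun y hy =>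
    Finset.sum_pos (fun x _ => hy x) Finset.univ_nonempty
  have key : ∀ y : Fin d → ℝ, (∀ x, 0 < y x) → u a ⬝ᵥ y ≤ 0 →
      (∀ c, 0 < u c ⬝ᵥ ξ → 0 < (u c - u a) ⬝ᵥ y) → (∑ x, y x)⁻¹ • y ∈ 𝒢.cell a := by
    intro y hy hay hcy
    refine 𝒢.inv_sum_smul_mem_cell (hsum y hy) (fun x => (hy x).le) fun c => ?_
    rw [hua]
    -- For losses on the segment, `u c - u a = (s - 1) • u a`, which is nonnegative at `y` since `s
    -- ≤ 1` and `u a ⬝ᵥ y ≤ 0`.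
    rcases hc c with h | ⟨s, hs0, hs1, hs⟩
    · exact (hcy c h).le
    · have hs' : u c = s • u a := hs
      rw [hs', sub_dotProduct, smul_dotProduct, smul_eq_mul]
      nlinarith
  have key' : ∀ y : Fin d → ℝ, (∀ x, 0 < y x) → u a ⬝ᵥ y = 0 →
      (∀ c, 0 < u c ⬝ᵥ ξ → 0 < (u c - u a) ⬝ᵥ y) → (∑ x, y x)⁻¹ • y ∈ 𝒢.cell b := by
    intro y hy hay hcy
    refine 𝒢.inv_sum_smul_mem_cell (hsum y hy) (fun x => (hy x).le) fun c => ?_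
    change 0 ≤ u c ⬝ᵥ y
    rcases hc c with h | ⟨s, hs0, hs1, hs⟩
    · have := hcy c h
      rw [sub_dotProduct, hay] at this
      linarith
    · have hs' : u c = s • u a := hs
      rw [hs', smul_dotProduct, hay, smul_zero]
  have hev : ∀ h : Fin d → ℝ, ∀ᶠ ε : ℝ in 𝓝[>] 0,
      ∀ c, 0 < u c ⬝ᵥ ξ → 0 < (u c - u a) ⬝ᵥ (ξ + ε • h) := by
    intro h
    rw [eventually_all]
    intro c
    by_cases hcξ : 0 < u c ⬝ᵥ ξ
    · have : 0 < (u c - u a) ⬝ᵥ ξ := by rw [sub_dotProduct, ha]; linarith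
      filter_upwards [eventually_dotProduct_add_smul_pos h this] with ε hε _ using hε
    · simp [hcξ]
  have hξc : ∀ c, 0 < u c ⬝ᵥ ξ → 0 < (u c - u a) ⬝ᵥ ξ := fun c h => by
    rw [sub_dotProduct, ha]; linarith
  have haξ : ξ ∈ Submodule.span ℝ (𝒢.cell a) :=
    mem_span_of_inv_sum_smul_mem (hsum ξ hξ) (key ξ hξ ha.le hξc)
  -- Near `ξ` the cone of `a` contains the half-space `u a ≤ 0`, and a half-space spans the whole
  -- space.
  have hle : ∀ h : Fin d → ℝ, u a ⬝ᵥ h ≤ 0 → h ∈ Submodule.span ℝ (𝒢.cell a) := by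
    intro h hh
    refine mem_span_of_eventually haξ ?_
    filter_upwards [eventually_add_smul_pos h hξ, hev h, self_mem_nhdsWithin] with ε h1 h2 hε
    have hε : 0 < ε := hε
    refine mem_span_of_inv_sum_smul_mem (hsum _ h1) (key _ h1 ?_ h2)
    rw [dotProduct_add, ha, dotProduct_smul, zero_add, smul_eq_mul]
    exact mul_nonpos_of_nonneg_of_nonpos hε.le hh
  refine ⟨hb, ?_, ?_⟩
  · rw [mem_pareto_iff_span_eq_top, eq_top_iff]
    intro h _
    rcases le_total (u a ⬝ᵥ h) 0 with hh | hh
    · exact hle h hh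
    · have := hle (-h) (by rw [dotProduct_neg]; linarith)
      simpa using Submodule.neg_mem _ this
  · have hu0 : u a ≠ 0 := fun h => hab (sub_eq_zero.1 h)
    -- Near `ξ` the two cones share the whole hyperplane `u a = 0`. Its linear dimension `d - 1` is
    -- affine dimension `d - 2`.
    have hspan : Submodule.span ℝ (𝒢.cell b ∩ 𝒢.cell a) =
        LinearMap.ker (dotProductBilin ℝ ℝ (u a)) := by
      apply le_antisymm
      · rw [Submodule.span_le]
        rintro y ⟨hyb, hya⟩
        change (𝒢.loss a - 𝒢.loss b) ⬝ᵥ y = 0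
        rw [sub_dotProduct]
        exact sub_eq_zero.2 (le_antisymm (hya.2 b) (hyb.2 a))
      · intro h hh
        have hh : u a ⬝ᵥ h = 0 := hh
        refine mem_span_of_eventually (mem_span_of_inv_sum_smul_mem (hsum ξ hξ)
          ⟨key' ξ hξ ha hξc, key ξ hξ ha.le hξc⟩) ?_
        filter_upwards [eventually_add_smul_pos h hξ, hev h] with ε h1 h2
        have h3 : u a ⬝ᵥ (ξ + ε • h) = 0 := by
          rw [dotProduct_add, ha, dotProduct_smul, hh, smul_zero, zero_add]
        exact mem_span_of_inv_sum_smul_mem (hsum _ h1) ⟨key' _ h1 h3 h2, key _ h1 h3.le h2⟩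
    rw [affDim_eq_finrank_span_sub_one fun y hy => hy.1.1, hspan]
    have hf : (dotProductBilin ℝ ℝ (u a) : (Fin d → ℝ) →ₗ[ℝ] ℝ) ≠ 0 := by
      intro h0
      have := LinearMap.congr_fun h0 (u a)
      exact hu0 (dotProduct_self_eq_zero.1 this)
    have h1 := LinearMap.finrank_range_add_finrank_ker
      (dotProductBilin ℝ ℝ (u a) : (Fin d → ℝ) →ₗ[ℝ] ℝ)
    rw [LinearMap.range_eq_top.2 (LinearMap.surjective hf), finrank_top, Module.finrank_self,
      Module.finrank_fin_fun] at h1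
    omega

/-- Away from its cell, a Pareto optimal action has a neighbour with smaller expected loss. -/
theorem exists_neighbours_expLoss_lt (hd : 0 < d) (hdup : 𝒢.NoDuplicates) {b : Fin k}
    (hb : b ∈ 𝒢.pareto) {ν : Fin d → ℝ} (hν : ν ∈ stdSimplex ℝ (Fin d)) (hνb : ν ∉ 𝒢.cell b) :
    ∃ a, 𝒢.Neighbours b a ∧ 𝒢.expLoss a ν < 𝒢.expLoss b ν := by
  classical
  set u : Fin k → Fin d → ℝ := fun c => 𝒢.loss c - 𝒢.loss b with hu
  obtain ⟨μ₀, hμ₀, hpos₀⟩ := 𝒢.exists_mem_cell_forall_pos hd hdup hb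
  have hN : {μ : Fin d → ℝ | ∀ a, a ≠ b → 0 < u a ⬝ᵥ μ} ∈ 𝓝 μ₀ := by
    change ∀ᶠ μ in 𝓝 μ₀, ∀ a, a ≠ b → 0 < u a ⬝ᵥ μ
    rw [eventually_all]
    intro a
    by_cases ha : a = b
    · simp [ha]
    · filter_upwards [(continuous_dotProduct_right (u a)).continuousAt.eventually
        (lt_mem_nhds (hpos₀ a ha))] with μ h _ using h
  -- These forms vanish at `μ` exactly when the ray `μ + t • ν` meets the hyperplanes of the two
  -- actions at the same `t`. For generic `μ` this forces the loss differences to be linearly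
  -- dependent.
  obtain ⟨μ, hμN, hμ, hμpos, hgen⟩ := exists_mem_nhds_dotProduct_ne_zero hd
    (fun ac : Fin k × Fin k => (u ac.1 ⬝ᵥ ν) • u ac.2 - (u ac.2 ⬝ᵥ ν) • u ac.1) hμ₀ hN
  have hμN : ∀ a, a ≠ b → 0 < u a ⬝ᵥ μ := hμN
  have hub : u b = 0 := by simp [hu]
  obtain ⟨a₀, ha₀⟩ : ∃ a, u a ⬝ᵥ ν < 0 := by
    by_contra! hcon
    refine hνb ⟨hν, fun a => ?_⟩
    have := hcon a
    simp only [hu, sub_dotProduct] at this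
    simp only [expLoss_eq_dotProduct]
    linarith
  -- the exit times, up to a monotone reparametrisation
  set ρ : Fin k → ℝ := fun a => u a ⬝ᵥ μ / -(u a ⬝ᵥ ν) with hρ
  obtain ⟨a₁, ha₁, hmin₁⟩ := Finset.exists_min_image
    (Finset.univ.filter fun a => u a ⬝ᵥ ν < 0) ρ ⟨a₀, by simpa using ha₀⟩
  -- Actions tied at the exit have proportional loss differences. The most negative one is the far
  -- end of the segment that `neighbours_of_wall` requires.
  obtain ⟨a, ha, hmin⟩ := Finset.exists_min_image
    (Finset.univ.filter fun a => u a ⬝ᵥ ν < 0 ∧ ρ a = ρ a₁) (fun a => u a ⬝ᵥ ν)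
    ⟨a₁, by simpa using ha₁⟩
  simp only [Finset.mem_filter, Finset.mem_univ, true_and] at ha ha₁ hmin₁ hmin
  have hne : ∀ c, u c ⬝ᵥ ν < 0 → c ≠ b := by
    rintro c hc rfl
    simp [hub] at hc
  have hρpos : ∀ c, u c ⬝ᵥ ν < 0 → 0 < ρ c := fun c hc =>
    div_pos (hμN c (hne c hc)) (by linarith)
  have hρeq : ∀ c, u c ⬝ᵥ ν < 0 → u c ⬝ᵥ μ = -(ρ c * (u c ⬝ᵥ ν)) := fun c hc => by
    have := hc.ne
    simp only [hρ]
    field_simp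
  have hr := hρpos a ha.1
  refine ⟨a, 𝒢.neighbours_of_wall hd hb (ξ := μ + ρ a • ν) (fun x => ?_)
    (hdup a b (hne a ha.1)) ?_ fun c => ?_, ?_⟩
  · have := mul_nonneg hr.le (hν.1 x)
    have := hμpos x
    simp only [Pi.add_apply, Pi.smul_apply, smul_eq_mul]
    linarith
  · change u a ⬝ᵥ _ = 0
    rw [dotProduct_add, dotProduct_smul, hρeq a ha.1, smul_eq_mul]
    ring
  · change 0 < u c ⬝ᵥ _ ∨ ∃ s : ℝ, 0 ≤ s ∧ s ≤ 1 ∧ u c = s • u a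
    rw [dotProduct_add, dotProduct_smul, smul_eq_mul]
    by_cases hcb : c = b
    · exact Or.inr ⟨0, le_rfl, zero_le_one, by rw [hcb, hub, zero_smul]⟩
    rcases le_or_gt 0 (u c ⬝ᵥ ν) with hcν | hcν
    · left
      have := hμN c hcb
      positivity
    rcases (hmin₁ c hcν).lt_or_eq with hlt | heq
    · left
      rw [hρeq c hcν, ha.2]
      nlinarith
    · right
      have hz : (u a ⬝ᵥ ν) • u c - (u c ⬝ᵥ ν) • u a = 0 := by
        by_contra hz
        refine hgen (a, c) hz ?_
        simp only [sub_dotProduct, smul_dotProduct, smul_eq_mul]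
        rw [hρeq c hcν, hρeq a ha.1, ha.2, ← heq]
        ring
      refine ⟨(u c ⬝ᵥ ν) / (u a ⬝ᵥ ν), (div_pos_of_neg_of_neg hcν ha.1).le, ?_, ?_⟩
      · rw [div_le_one_of_neg ha.1]
        exact hmin c ⟨hcν, heq.symm⟩
      · rw [div_eq_inv_mul, mul_smul, ← sub_eq_zero.1 hz, smul_smul, inv_mul_cancel₀ ha.1.ne,
          one_smul]
  · have := ha.1
    simp only [hu, sub_dotProduct] at this
    simp only [expLoss_eq_dotProduct]
    linarith

/-- At every law `ν` the Pareto optimal actions can be ranked, compatibly with their expected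
losses, so that every action but an optimal one has a neighbour of smaller rank. -/
theorem exists_rank (hk : 0 < k) (hd : 0 < d) (hdup : 𝒢.NoDuplicates) {ν : Fin d → ℝ}
    (hν : ν ∈ stdSimplex ℝ (Fin d)) :
    ∃ (l : Fin k → ℝ) (r : Fin k), r ∈ 𝒢.pareto ∧ (∀ c, 𝒢.expLoss r ν ≤ 𝒢.expLoss c ν) ∧
      (∀ a b, l a < l b → 𝒢.expLoss a ν ≤ 𝒢.expLoss b ν) ∧
      ∀ b ∈ 𝒢.pareto, b ≠ r → ∃ a, 𝒢.Neighbours b a ∧ l a < l b := by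
  have : Nonempty (Fin k) := ⟨⟨0, hk⟩⟩
  have hN : {μ : Fin d → ℝ | ∀ a b, 𝒢.loss a ⬝ᵥ ν < 𝒢.loss b ⬝ᵥ ν →
      𝒢.loss a ⬝ᵥ μ < 𝒢.loss b ⬝ᵥ μ} ∈ 𝓝 ν := by
    change ∀ᶠ μ in 𝓝 ν, ∀ a b, 𝒢.loss a ⬝ᵥ ν < 𝒢.loss b ⬝ᵥ ν → 𝒢.loss a ⬝ᵥ μ < 𝒢.loss b ⬝ᵥ μ
    rw [eventually_all]
    intro a
    rw [eventually_all]
    intro b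
    by_cases h : 𝒢.loss a ⬝ᵥ ν < 𝒢.loss b ⬝ᵥ ν
    · filter_upwards [(continuous_dotProduct_right (𝒢.loss a)).continuousAt.eventually_lt
        (continuous_dotProduct_right (𝒢.loss b)).continuousAt h] with μ hμ _ using hμ
    · simp [h]
  -- Actions are ranked by their expected loss at a generic `μ` close to `ν`. There are no ties at
  -- `μ`, so the minimiser is unique, and strict comparisons at `ν` persist at `μ`.
  obtain ⟨μ, hμN, hμ, hμpos, hgen⟩ := exists_mem_nhds_dotProduct_ne_zero hd
    (fun ab : Fin k × Fin k => 𝒢.loss ab.1 - 𝒢.loss ab.2) hν hN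
  have hle : ∀ a b, 𝒢.expLoss a μ ≤ 𝒢.expLoss b μ → 𝒢.expLoss a ν ≤ 𝒢.expLoss b ν := by
    intro a b hab
    by_contra! hcon
    exact absurd (hμN b a hcon) (not_lt.2 hab)
  obtain ⟨r, hr⟩ := Finite.exists_min fun a => 𝒢.expLoss a μ
  have hrlt : ∀ c, c ≠ r → 𝒢.expLoss r μ < 𝒢.expLoss c μ := by
    intro c hc
    refine lt_of_le_of_ne (hr c) fun h => ?_
    refine hgen (c, r) (sub_ne_zero.2 (hdup c r hc)) ?_
    simp only [sub_dotProduct]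
    exact sub_eq_zero.2 h.symm
  refine ⟨fun a => 𝒢.expLoss a μ, r, 𝒢.mem_pareto_of_forall_lt hd hμpos hrlt,
    fun c => hle r c (hr c), fun a b h => hle a b h.le, fun b hb hbr => ?_⟩
  exact 𝒢.exists_neighbours_expLoss_lt hd hdup hb hμ fun h => absurd (h.2 r) (not_le.2 (hrlt b hbr))

end PMGame

/-! ### Bounded estimators: truncation on one edge, telescoping along a chain. -/

/-- A potential on `ℝ` of total variation at most `#T` which increases at unit speed to the right
of each point of the finite set `T`, over unit distance. -/
theorem exists_truncated_potential (T : Finset ℝ) :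
    ∃ f : ℝ → ℝ, (∀ s, 0 ≤ f s ∧ f s ≤ T.card) ∧
      ∀ s ∈ T, ∀ s', s ≤ s' → s' ≤ s + 1 → f s' - f s = s' - s := by
  classical
  -- The potential at `s` is the length of `U` to the left of `s`; gaps longer than `1` between
  -- points of `T` are thereby collapsed.
  let U : Set ℝ := ⋃ t ∈ T, Set.Ioc t (t + 1)
  have hUm : MeasurableSet U := T.measurableSet_biUnion fun t _ => measurableSet_Ioc
  have hUle : volume U ≤ T.card := by
    refine (measure_biUnion_finset_le T _).trans ?_
    simp
  have hUfin : volume U ≠ ⊤ := ne_top_of_le_ne_top (by simp) hUle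
  refine ⟨fun s => volume.real (Set.Iic s ∩ U), fun s => ⟨measureReal_nonneg, ?_⟩, ?_⟩
  · have h1 : volume (Set.Iic s ∩ U) ≤ T.card := (measure_mono Set.inter_subset_right).trans hUle
    simpa [measureReal_def] using ENNReal.toReal_mono (by simp) h1
  · intro s hs s' hss' hs'
    have hsplit : Set.Iic s' ∩ U = (Set.Iic s ∩ U) ∪ Set.Ioc s s' := by
      ext y
      simp only [Set.mem_inter_iff, Set.mem_Iic, Set.mem_union, Set.mem_Ioc]
      constructor
      · rintro ⟨h1, h2⟩
        rcases le_or_gt y s with h | h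
        · exact Or.inl ⟨h, h2⟩
        · exact Or.inr ⟨h, h1⟩
      · rintro (⟨h1, h2⟩ | ⟨h1, h2⟩)
        · exact ⟨h1.trans hss', h2⟩
        · exact ⟨h2, Set.mem_biUnion (x := s) hs ⟨h1, h2.trans hs'⟩⟩
    have hdisj : Disjoint (Set.Iic s ∩ U) (Set.Ioc s s') := by
      rw [Set.disjoint_left]
      rintro y ⟨h1, _⟩ ⟨h2, _⟩
      exact absurd h2 (not_lt.2 h1)
    have hfin : volume (Set.Iic s ∩ U) ≠ ⊤ :=
      ne_top_of_le_ne_top hUfin (measure_mono Set.inter_subset_right)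
    simp only
    rw [hsplit, measureReal_union hdisj measurableSet_Ioc hfin (by simp)]
    simp [hss']

namespace PMGame

variable {k d : ℕ} {S : Type*} (𝒢 : PMGame k d S)

theorem card_image_signal_le [Finite S] (a : Fin k) {α : Type*} [DecidableEq α] (u : S → α) :
    (Finset.univ.image fun x => u (𝒢.signal a x)).card ≤ 𝒢.maxSignals := by
  have h1 : (Set.range (𝒢.signal a)).ncard ≤ 𝒢.maxSignals :=
    Finset.le_sup (f := fun a : Fin k => (Set.range (𝒢.signal a)).ncard) (Finset.mem_univ a)
  refine le_trans ?_ h1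
  rw [← Set.ncard_coe_finset]
  have : ((Finset.univ.image fun x => u (𝒢.signal a x) : Finset α) : Set α)
      = u '' Set.range (𝒢.signal a) := by
    ext y; simp
  rw [this]
  exact Set.ncard_image_le (Set.toFinite _)

theorem one_le_maxSignals [Finite S] (hk : 0 < k) (hd : 0 < d) : 1 ≤ 𝒢.maxSignals := by
  classical
  refine le_trans ?_ (𝒢.card_image_signal_le ⟨0, hk⟩ id)
  exact Finset.card_pos.2 ⟨_, Finset.mem_image_of_mem _ (Finset.mem_univ ⟨0, hd⟩)⟩

theorem not_neighbours_self (a : Fin k) : ¬ 𝒢.Neighbours a a := by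
  rintro ⟨h1, -, h2⟩
  have h1 : affDim (𝒢.cell a) = (d : ℤ) - 1 := h1
  rw [Set.inter_self] at h2
  omega

/-- The loss difference of neighbours can be estimated by functions bounded by the maximal number
of signals. -/
theorem LocallyObservable.exists_bounded [Finite S] (hloc : 𝒢.LocallyObservable) {a b : Fin k}
    (hab : 𝒢.Neighbours a b) : ∃ w : Fin k → S → ℝ,
      (∀ x, ∑ c, w c (𝒢.signal c x) = 𝒢.loss a x - 𝒢.loss b x) ∧
      (∀ c, c ≠ a → c ≠ b → ∀ σ, w c σ = 0) ∧ ∀ c σ, |w c σ| ≤ 𝒢.maxSignals := by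
  classical
  obtain ⟨w, hw, hw0⟩ := hloc a b hab
  have hne : a ≠ b := by
    rintro rfl
    exact 𝒢.not_neighbours_self _ hab
  have hsum : ∀ w : Fin k → S → ℝ, (∀ c, c ≠ a → c ≠ b → ∀ σ, w c σ = 0) → ∀ x,
      ∑ c, w c (𝒢.signal c x) = w a (𝒢.signal a x) + w b (𝒢.signal b x) := by
    intro w hw x
    exact Fintype.sum_eq_add a b hne fun c hc => hw c hc.1 hc.2 _
  -- A loss difference is `w a - (-w b)` and lies in `[-1, 1]`, so it only compares points of `T` at
  -- distance at most `1`. The potential preserves such differences.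
  set T : Finset ℝ := (Finset.univ.image fun x => w a (𝒢.signal a x)) ∪
    Finset.univ.image fun x => (fun σ => -w b σ) (𝒢.signal b x) with hT
  obtain ⟨f, hf, hfT⟩ := exists_truncated_potential T
  have hcard : (T.card : ℝ) ≤ 2 * 𝒢.maxSignals := by
    have : T.card ≤ 2 * 𝒢.maxSignals := by
      refine (Finset.card_union_le _ _).trans ?_
      have := 𝒢.card_image_signal_le a (w a)
      have : (Finset.univ.image fun x => (fun σ => -w b σ) (𝒢.signal b x)).card ≤ 𝒢.maxSignals :=
        𝒢.card_image_signal_le b (fun σ => -w b σ)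
      omega
    exact_mod_cast this
  have hfd : ∀ s ∈ T, ∀ s' ∈ T, |s' - s| ≤ 1 → f s' - f s = s' - s := by
    intro s hs s' hs' h
    rw [abs_le] at h
    rcases le_total s s' with hle | hle
    · exact hfT s hs s' hle (by linarith)
    · have := hfT s' hs' s hle (by linarith)
      linarith
  have hbd : ∀ s, |f s - 𝒢.maxSignals| ≤ 𝒢.maxSignals := fun s => by
    have := hf s
    rw [abs_le]
    constructor <;> linarith
  -- The potential has values in `[0, 2m]`; recentring at `m` bounds it by `m`, and the shift
  -- cancels between the two actions.
  set w' : Fin k → S → ℝ := fun c σ => if c = a then f (w a σ) - 𝒢.maxSignals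
    else if c = b then -(f (-w b σ) - 𝒢.maxSignals) else 0 with hw'
  have hw'0 : ∀ c, c ≠ a → c ≠ b → ∀ σ, w' c σ = 0 := fun c h1 h2 σ => by simp [hw', h1, h2]
  refine ⟨w', fun x => ?_, hw'0, fun c σ => ?_⟩
  · rw [hsum w' hw'0]
    have h1 := hw x
    rw [hsum w hw0] at h1
    have ha := 𝒢.loss_mem a x
    have hb := 𝒢.loss_mem b x
    have h2 := hfd (-w b (𝒢.signal b x)) (by
        rw [hT]
        exact Finset.mem_union_right _ (Finset.mem_image_of_mem _ (Finset.mem_univ x)))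
      (w a (𝒢.signal a x)) (by
        rw [hT]
        exact Finset.mem_union_left _ (Finset.mem_image_of_mem _ (Finset.mem_univ x)))
      (by rw [abs_le]; constructor <;> linarith [ha.1, ha.2, hb.1, hb.2])
    simp only [hw', if_true, hne.symm, if_false]
    linarith
  · simp only [hw']
    split_ifs
    · exact hbd _
    · rw [abs_neg]; exact hbd _
    · simp

/-- Estimation functions obtained by summing along a chain of neighbours of decreasing rank. -/
theorem LocallyObservable.exists_estimator [Finite S] (hloc : 𝒢.LocallyObservable) (l : Fin k → ℝ)
    (r : Fin k) (hl : ∀ b ∈ 𝒢.pareto, b ≠ r → ∃ a, 𝒢.Neighbours b a ∧ l a < l b) :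
    ∀ b ∈ 𝒢.pareto, ∃ (P : Finset (Fin k)) (G : Fin k → S → ℝ), b ∈ P ∧
      (∀ x, ∑ a, G a (𝒢.signal a x) = 𝒢.loss b x - 𝒢.loss r x) ∧
      (∀ a ∉ P, ∀ σ, G a σ = 0) ∧ (∀ a ∈ P, a ≠ b → l a < l b) ∧
      (∀ a σ, |G a σ| ≤ 2 * 𝒢.maxSignals) ∧ (∀ σ, |G b σ| ≤ 𝒢.maxSignals) ∧
      ∀ a σ, |G a σ| ≤ ((P.card : ℝ) - 1) * 𝒢.maxSignals := by
  classical
  have hm : (0 : ℝ) ≤ 𝒢.maxSignals := Nat.cast_nonneg _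
  have hwf : WellFounded fun a b => l a < l b := by
    have : IsTrans (Fin k) fun a b => l a < l b := ⟨fun _ _ _ => lt_trans⟩
    have : Std.Irrefl fun a b : Fin k => l a < l b := ⟨fun _ => lt_irrefl _⟩
    exact Finite.wellFounded_of_trans_of_irrefl _
  intro b
  induction b using hwf.induction with
  | _ b ih =>
    intro hb
    by_cases hbr : b = r
    · subst hbr
      refine ⟨{b}, fun _ _ => 0, by simp, by simp, by simp, by simp, ?_, ?_, ?_⟩ <;> simp [hm]
    · obtain ⟨a, hba, hlt⟩ := hl b hb hbr
      obtain ⟨P, G, haP, hG, hG0, hPl, hG2, hGa, hGP⟩ := ih a hlt hba.2.1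
      obtain ⟨w, hw, hw0, hwm⟩ := hloc.exists_bounded 𝒢 hba
      have hbP : b ∉ P := fun h => by
        have hne : b ≠ a := by rintro rfl; exact lt_irrefl _ hlt
        exact lt_asymm hlt (hPl b h hne)
      have hadd : ∀ c σ, |G c σ + w c σ| ≤ |G c σ| + |w c σ| := fun c σ => abs_add_le _ _
      have hbb : ∀ σ, |G b σ + w b σ| ≤ 𝒢.maxSignals := fun σ => by
        rw [hG0 b hbP, zero_add]
        exact hwm b σ
      refine ⟨insert b P, fun c σ => G c σ + w c σ, by simp, fun x => ?_, fun c hc σ => ?_,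
        fun c hc hcb => ?_, fun c σ => ?_, hbb, fun c σ => ?_⟩
      · rw [Finset.sum_add_distrib, hG, hw]
        ring
      · rw [Finset.mem_insert, not_or] at hc
        have hca : c ≠ a := by rintro rfl; exact hc.2 haP
        simp only [hG0 c hc.2, hw0 c hc.1 hca, zero_add]
      · have hcP := (Finset.mem_insert.1 hc).resolve_left hcb
        rcases eq_or_ne c a with rfl | hca
        · exact hlt
        · exact (hPl c hcP hca).trans hlt
      -- The new link from `b` to `a` changes the estimator only at its endpoints: `b` is new, and
      -- `a`, the start of the old chain, had met only one link. This is why the bound `m` at the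
      -- starting action is carried along.
      · by_cases hcb : c = b
        · subst hcb
          linarith [hbb σ]
        by_cases hca : c = a
        · subst hca
          linarith [hadd c σ, hGa σ, hwm c σ]
        · simp only [hw0 c hcb hca, add_zero]
          exact hG2 c σ
      · rw [Finset.card_insert_of_notMem hbP]
        push_cast
        linarith [hadd c σ, hGP c σ, hwm c σ]

end PMGame

/-! ### Minimax theorem and convexity of the objective. -/

/-- A minimax theorem for finitely many convex functions. -/
theorem exists_forall_lt_of_forall_stdSimplex {ι E : Type*} [Fintype ι] [Nonempty ι]
    [AddCommGroup E] [Module ℝ E] {K : Set E} {f : ι → E → ℝ} (hf : ∀ i, ConvexOn ℝ K (f i))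
    {V ε : ℝ} (hε : 0 < ε) (h : ∀ ν ∈ stdSimplex ℝ ι, ∃ y ∈ K, ∑ i, ν i * f i y ≤ V) :
    ∃ y ∈ K, ∀ i, f i y < V + ε := by
  classical
  by_contra hcon
  -- The value vectors that are strictly dominated from below form an open convex set. If the
  -- conclusion fails, this set misses the constant vector `V + ε` and can be separated from it.
  set U : Set (ι → ℝ) := {u | ∃ y ∈ K, ∀ i, f i y < u i} with hU
  have hUopen : IsOpen U := by
    have : U = ⋃ y ∈ K, Set.univ.pi fun i => Set.Ioi (f i y) := by
      ext u; simp [hU, Set.mem_pi]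
    rw [this]
    exact isOpen_biUnion fun y _ => isOpen_set_pi Set.finite_univ fun i _ => isOpen_Ioi
  have hUconv : Convex ℝ U := by
    rintro u ⟨y, hy, hyu⟩ v ⟨z, hz, hzv⟩ α β hα hβ hαβ
    refine ⟨α • y + β • z, (hf (Classical.arbitrary ι)).1 hy hz hα hβ hαβ, fun i => ?_⟩
    refine ((hf i).2 hy hz hα hβ hαβ).trans_lt ?_
    simp only [smul_eq_mul, Pi.add_apply, Pi.smul_apply]
    rcases hα.eq_or_lt with rfl | hα
    · have : β = 1 := by linarith
      subst this
      linarith [hzv i]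
    · have h1 := mul_lt_mul_of_pos_left (hyu i) hα
      have h2 := mul_le_mul_of_nonneg_left (hzv i).le hβ
      linarith
  have hcU : (fun _ => V + ε) ∉ U := fun ⟨y, hy, hyu⟩ => hcon ⟨y, hy, hyu⟩
  obtain ⟨φ, hφ⟩ := geometric_hahn_banach_open_point hUconv hUopen hcU
  set w : ι → ℝ := fun i => φ (Pi.single i 1) with hw
  have hφw : ∀ u : ι → ℝ, φ u = ∑ i, u i * w i := by
    intro u
    conv_lhs => rw [pi_eq_sum_univ' u]
    simp only [map_sum, map_smul, smul_eq_mul, hw]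
  obtain ⟨y₀, hy₀, -⟩ := h (Pi.single (Classical.arbitrary ι) 1) (single_mem_stdSimplex ℝ _)
  have hu₀ : (fun i => f i y₀ + 1) ∈ U := ⟨y₀, hy₀, fun i => by linarith⟩
  -- `U` is closed upwards, so a positive weight would make the functional unbounded above on `U`.
  -- Normalising `-w` then yields a law `ν` that contradicts `h`.
  have hw0 : ∀ i, w i ≤ 0 := by
    intro i
    by_contra! hi
    set t : ℝ := max 0 ((φ (fun _ => V + ε) - φ (fun i => f i y₀ + 1)) / w i) with ht
    have hmem : (fun i => f i y₀ + 1) + t • (Pi.single i 1 : ι → ℝ) ∈ U := by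
      refine ⟨y₀, hy₀, fun j => ?_⟩
      have : 0 ≤ t * (Pi.single i 1 : ι → ℝ) j := by
        refine mul_nonneg (le_max_left _ _) ?_
        by_cases hij : j = i
        · subst hij; simp
        · simp [hij]
      simp only [Pi.add_apply, Pi.smul_apply, smul_eq_mul]
      linarith
    have h1 := hφ _ hmem
    rw [map_add, map_smul, smul_eq_mul] at h1
    have h2 : (φ (fun _ => V + ε) - φ (fun i => f i y₀ + 1)) / w i ≤ t := le_max_right _ _
    rw [div_le_iff₀ hi] at h2
    change _ + t * w i < _ at h1
    linarith
  have hW : 0 < ∑ i, -w i := by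
    refine lt_of_le_of_ne (Finset.sum_nonneg fun i _ => by linarith [hw0 i]) fun h0 => ?_
    have hz : ∀ i, w i = 0 := fun i => by
      have := (Finset.sum_eq_zero_iff_of_nonneg (fun i _ => by linarith [hw0 i])).1 h0.symm i
        (Finset.mem_univ i)
      linarith
    have := hφ _ hu₀
    simp [hφw, hz] at this
  set W : ℝ := ∑ i, -w i with hWdef
  obtain ⟨y, hy, hyV⟩ := h (fun i => -w i / W)
    ⟨fun i => div_nonneg (by linarith [hw0 i]) hW.le, by
      rw [← Finset.sum_div, ← hWdef, div_self hW.ne']⟩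
  have h1 := hφ (fun i => f i y + ε / 2) ⟨y, hy, fun i => by linarith⟩
  rw [hφw, hφw] at h1
  have h2 : ∑ i, (f i y + ε / 2) * w i = -(W * ∑ i, -w i / W * f i y) - ε / 2 * W := by
    rw [Finset.mul_sum, hWdef, ← Finset.sum_neg_distrib, Finset.mul_sum, ← Finset.sum_sub_distrib]
    refine Finset.sum_congr rfl fun i _ => ?_
    rw [← hWdef]
    field_simp
    ring
  have h3 : ∑ i, (V + ε) * w i = -((V + ε) * W) := by
    rw [hWdef, Finset.mul_sum, ← Finset.sum_neg_distrib]
    exact Finset.sum_congr rfl fun i _ => by ring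
  rw [h2, h3] at h1
  have h4 := mul_le_mul_of_nonneg_left hyV hW.le
  nlinarith

/-- The perspective of the exponential is convex. -/
theorem perspective_exp_neg_le {p₁ p₂ z₁ z₂ α β : ℝ} (hp₁ : 0 < p₁) (hp₂ : 0 < p₂) (hα : 0 ≤ α)
    (hβ : 0 ≤ β) (hαβ : α + β = 1) :
    (α * p₁ + β * p₂) * Real.exp (-((α * z₁ + β * z₂) / (α * p₁ + β * p₂))) ≤
      α * (p₁ * Real.exp (-(z₁ / p₁))) + β * (p₂ * Real.exp (-(z₂ / p₂))) := by
  have hP : 0 < α * p₁ + β * p₂ := by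
    rcases hα.eq_or_lt with rfl | hα
    · have : β = 1 := by linarith
      subst this
      simpa using hp₂
    · have := mul_pos hα hp₁
      have := mul_nonneg hβ hp₂.le
      linarith
  set P := α * p₁ + β * p₂
  have h := convexOn_exp.2 (Set.mem_univ (-(z₁ / p₁))) (Set.mem_univ (-(z₂ / p₂)))
    (show 0 ≤ α * p₁ / P by positivity) (show 0 ≤ β * p₂ / P by positivity)
    (by rw [← add_div]; exact div_self hP.ne')
  simp only [smul_eq_mul] at h
  have h1 : α * p₁ / P * -(z₁ / p₁) + β * p₂ / P * -(z₂ / p₂) = -((α * z₁ + β * z₂) / P) := by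
    field_simp
    ring
  rw [h1] at h
  calc _ ≤ P * (α * p₁ / P * Real.exp (-(z₁ / p₁)) + β * p₂ / P * Real.exp (-(z₂ / p₂))) :=
        mul_le_mul_of_nonneg_left h hP.le
    _ = _ := by field_simp

namespace PMGame

variable {k d : ℕ} {S : Type*} (𝒢 : PMGame k d S)

/-- Only the exponential needs convexity: after multiplication by `p`, the remaining terms of `stab`
are linear in `(p, z)`. -/
theorem perspective_stab_le {q z₁ z₂ : Fin k → ℝ} (hq : ∀ b, 0 ≤ q b) {p₁ p₂ α β : ℝ}
    (hp₁ : 0 < p₁) (hp₂ : 0 < p₂) (hα : 0 ≤ α) (hβ : 0 ≤ β) (hαβ : α + β = 1) :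
    (α * p₁ + β * p₂) * stab q (fun b => (α * z₁ b + β * z₂ b) / (α * p₁ + β * p₂)) ≤
      α * (p₁ * stab q fun b => z₁ b / p₁) + β * (p₂ * stab q fun b => z₂ b / p₂) := by
  have hP : 0 < α * p₁ + β * p₂ := by
    rcases hα.eq_or_lt with rfl | hα
    · have : β = 1 := by linarith
      subst this
      simpa using hp₂
    · have := mul_pos hα hp₁
      have := mul_nonneg hβ hp₂.le
      linarith
  simp only [stab, Finset.mul_sum, ← Finset.sum_add_distrib]
  refine Finset.sum_le_sum fun b _ => ?_
  have h := mul_le_mul_of_nonneg_left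
    (perspective_exp_neg_le (z₁ := z₁ b) (z₂ := z₂ b) hp₁ hp₂ hα hβ hαβ) (hq b)
  have h1 : (α * p₁ + β * p₂) * ((α * z₁ b + β * z₂ b) / (α * p₁ + β * p₂)) =
      α * z₁ b + β * z₂ b := mul_div_cancel₀ _ hP.ne'
  have h2 : p₁ * (z₁ b / p₁) = z₁ b := mul_div_cancel₀ _ hp₁.ne'
  have h3 : p₂ * (z₂ b / p₂) = z₂ b := mul_div_cancel₀ _ hp₂.ne'
  calc _ = q b * ((α * p₁ + β * p₂) *
        Real.exp (-((α * z₁ b + β * z₂ b) / (α * p₁ + β * p₂)))) +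
        q b * ((α * p₁ + β * p₂) * ((α * z₁ b + β * z₂ b) / (α * p₁ + β * p₂))
          - (α * p₁ + β * p₂)) := by ring
    _ ≤ q b * (α * (p₁ * Real.exp (-(z₁ b / p₁))) + β * (p₂ * Real.exp (-(z₂ b / p₂)))) +
        q b * (α * z₁ b + β * z₂ b - (α * p₁ + β * p₂)) := by rw [h1]; linarith
    _ = q b * (α * (p₁ * Real.exp (-(z₁ b / p₁))) + β * (p₂ * Real.exp (-(z₂ b / p₂)))) +
        q b * (α * (p₁ * (z₁ b / p₁)) + β * (p₂ * (z₂ b / p₂)) - (α * p₁ + β * p₂)) := by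
          rw [h2, h3]
    _ = _ := by ring

/-- The objective as a real number, for sampling distributions with full support. -/
noncomputable def realObjective (η : ℝ) (q : Fin k → ℝ) (G : Fin k → S → Fin k → ℝ) (p : Fin k → ℝ)
    (x : Fin d) : ℝ :=
  ((∑ a, (p a - q a) * 𝒢.loss a x) + 𝒢.bias q G x) / η +
    1 / η ^ 2 * ∑ a, p a * stab q fun b => η * G a (𝒢.signal a x) b / p a

theorem coe_sum_eReal {ι : Type*} (s : Finset ι) (f : ι → ℝ) :
    ((∑ i ∈ s, f i : ℝ) : EReal) = ∑ i ∈ s, (f i : EReal) := by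
  classical
  induction s using Finset.induction_on with
  | empty => simp
  | insert a s ha ih => rw [Finset.sum_insert ha, Finset.sum_insert ha, EReal.coe_add, ih]

theorem objective_eq_realObjective {η : ℝ} {q : Fin k → ℝ} {G : Fin k → S → Fin k → ℝ}
    {p : Fin k → ℝ} (hp : ∀ a, 0 < p a) (x : Fin d) :
    𝒢.objective η q G p x = (𝒢.realObjective η q G p x : EReal) := by
  rw [objective, realObjective, EReal.coe_add, EReal.coe_mul, coe_sum_eReal]
  simp only [perspStab, hp, if_true]

/-- Estimation functions and sampling distributions with full support. -/
def designs (k : ℕ) (S : Type*) : Set ((Fin k → S → Fin k → ℝ) × (Fin k → ℝ)) :=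
  {y | y.2 ∈ stdSimplex ℝ (Fin k) ∧ ∀ a, 0 < y.2 a}

theorem convex_designs : Convex ℝ (designs k S) := by
  rintro y hy z hz α β hα hβ hαβ
  refine ⟨convex_stdSimplex ℝ _ hy.1 hz.1 hα hβ hαβ, fun a => ?_⟩
  exact convex_Ioi (0 : ℝ) (hy.2 a) (hz.2 a) hα hβ hαβ

/-- An affine function plus a finite maximum of affine functions of `G`. -/
theorem convexOn_bias (hne : 𝒢.pareto.Nonempty) (q : Fin k → ℝ) (x : Fin d) :
    ConvexOn ℝ (designs k S) fun y => 𝒢.bias q y.1 x := by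
  have : Nonempty 𝒢.pareto := hne.to_subtype
  refine ConvexOn.add ⟨convex_designs, fun y _ z _ α β hα hβ hαβ => le_of_eq ?_⟩
    ⟨convex_designs, fun y _ z _ α β hα hβ hαβ => ciSup_le fun c => ?_⟩
  · simp only [smul_eq_mul, Finset.mul_sum, ← Finset.sum_add_distrib]
    refine Finset.sum_congr rfl fun b _ => ?_
    simp only [Prod.fst_add, Prod.smul_fst, Pi.add_apply, Pi.smul_apply, smul_eq_mul,
      Finset.sum_add_distrib, ← Finset.mul_sum]
    linear_combination -(q b * 𝒢.loss b x) * hαβ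
  · have hb : ∀ y : (Fin k → S → Fin k → ℝ) × (Fin k → ℝ),
        (∑ a, y.1 a (𝒢.signal a x) c) - 𝒢.loss c x ≤
          ⨆ c : 𝒢.pareto, ((∑ a, y.1 a (𝒢.signal a x) c) - 𝒢.loss c x) := fun y =>
      le_ciSup (f := fun c : 𝒢.pareto => (∑ a, y.1 a (𝒢.signal a x) c) - 𝒢.loss c x)
        (Set.finite_range _).bddAbove c
    have h1 := mul_le_mul_of_nonneg_left (hb y) hα
    have h2 := mul_le_mul_of_nonneg_left (hb z) hβ
    simp only [Prod.fst_add, Prod.smul_fst, Pi.add_apply, Pi.smul_apply, smul_eq_mul,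
      Finset.sum_add_distrib, ← Finset.mul_sum]
    refine le_trans (le_of_eq ?_) (add_le_add h1 h2)
    linear_combination 𝒢.loss c x * hαβ

theorem convexOn_realObjective (hne : 𝒢.pareto.Nonempty) {η : ℝ} (hη : 0 < η) {q : Fin k → ℝ}
    (hq : ∀ b, 0 ≤ q b) (x : Fin d) :
    ConvexOn ℝ (designs k S) fun y => 𝒢.realObjective η q y.1 y.2 x := by
  have h1 : ConvexOn ℝ (designs k S) fun y => ∑ a, (y.2 a - q a) * 𝒢.loss a x := by
    refine ⟨convex_designs, fun y _ z _ α β hα hβ hαβ => le_of_eq ?_⟩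
    simp only [smul_eq_mul, Finset.mul_sum, ← Finset.sum_add_distrib]
    refine Finset.sum_congr rfl fun a _ => ?_
    simp only [Prod.snd_add, Prod.smul_snd, Pi.add_apply, Pi.smul_apply, smul_eq_mul]
    linear_combination (q a * 𝒢.loss a x) * hαβ
  have h2 : ConvexOn ℝ (designs k S) fun y =>
      ∑ a, y.2 a * stab q fun b => η * y.1 a (𝒢.signal a x) b / y.2 a := by
    refine ⟨convex_designs, fun y hy z hz α β hα hβ hαβ => ?_⟩
    simp only [smul_eq_mul, Finset.mul_sum, ← Finset.sum_add_distrib]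
    refine Finset.sum_le_sum fun a _ => ?_
    refine le_trans (le_of_eq ?_) (perspective_stab_le hq (hy.2 a) (hz.2 a) hα hβ hαβ)
    simp only [Prod.snd_add, Prod.smul_snd, Prod.fst_add, Prod.smul_fst, Pi.add_apply,
      Pi.smul_apply, smul_eq_mul]
    congr 2
    funext b
    ring
  have h3 := ((h1.add (𝒢.convexOn_bias hne q x)).smul (inv_nonneg.2 hη.le)).add
    (h2.smul (c := 1 / η ^ 2) (by positivity))
  refine h3.congr fun y _ => ?_
  simp only [realObjective, Pi.add_apply, smul_eq_mul, div_eq_inv_mul]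

end PMGame

/-! ### A good design for a known law of the outcomes. -/

namespace PMGame

variable {k d : ℕ} {S : Type*} (𝒢 : PMGame k d S)

theorem expLoss_mem_Icc {ν : Fin d → ℝ} (hν : ν ∈ stdSimplex ℝ (Fin d)) (a : Fin k) :
    𝒢.expLoss a ν ∈ Set.Icc (0 : ℝ) 1 := by
  refine ⟨Finset.sum_nonneg fun x _ => mul_nonneg (𝒢.loss_mem a x).1 (hν.1 x), ?_⟩
  rw [← hν.2]
  exact Finset.sum_le_sum fun x _ => mul_le_of_le_one_left (hν.1 x) (𝒢.loss_mem a x).2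

/-- If `G` estimates the losses of the Pareto optimal actions relative to a fixed action `r`, then
the linear part of the objective does not depend on `r`. -/
theorem bias_eq_of_estimator (hne : 𝒢.pareto.Nonempty) {q : Fin k → ℝ} (hq : ∑ b, q b = 1)
    {G : Fin k → S → Fin k → ℝ} {base : Fin k → Fin k} {r : Fin k}
    (hbase : ∀ c ∈ 𝒢.pareto, base c = c)
    (hG : ∀ b x, ∑ a, G a (𝒢.signal a x) b = 𝒢.loss (base b) x - 𝒢.loss r x) (x : Fin d) :
    𝒢.bias q G x = ∑ b, q b * (𝒢.loss b x - 𝒢.loss (base b) x) := by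
  have : Nonempty 𝒢.pareto := hne.to_subtype
  have h1 : ∀ c : 𝒢.pareto, (∑ a, G a (𝒢.signal a x) c) - 𝒢.loss c x = -𝒢.loss r x := fun c => by
    rw [hG, hbase c c.2]; ring
  rw [bias]
  simp only [h1, ciSup_const]
  simp only [hG]
  have h2 : ∑ b, q b * (𝒢.loss b x - (𝒢.loss (base b) x - 𝒢.loss r x)) =
      ∑ b, q b * (𝒢.loss b x - 𝒢.loss (base b) x) + (∑ b, q b) * 𝒢.loss r x := by
    rw [Finset.sum_mul, ← Finset.sum_add_distrib]
    exact Finset.sum_congr rfl fun b _ => by ring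
  rw [h2, hq]
  ring

/-- Moving the mass of each action `b` uniformly to a set `P b` of better actions, and mixing with
the uniform distribution, gives a sampling distribution with a good value at `ν`. -/
theorem exists_design_of_estimator (hne : 𝒢.pareto.Nonempty) {q : Fin k → ℝ}
    (hq : q ∈ stdSimplex ℝ (Fin k)) {ν : Fin d → ℝ} (hν : ν ∈ stdSimplex ℝ (Fin d))
    {G : Fin k → S → Fin k → ℝ} {base : Fin k → Fin k} {r : Fin k} {P : Fin k → Finset (Fin k)}
    {B η : ℝ} (hbase : ∀ c ∈ 𝒢.pareto, base c = c)
    (hG : ∀ b x, ∑ a, G a (𝒢.signal a x) b = 𝒢.loss (base b) x - 𝒢.loss r x)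
    (hP : ∀ b, (P b).Nonempty) (hG0 : ∀ b, ∀ a ∉ P b, ∀ σ, G a σ b = 0)
    (hPl : ∀ b, ∀ a ∈ P b, 𝒢.expLoss a ν ≤ 𝒢.expLoss (base b) ν)
    (hGB : ∀ a σ b, |G a σ b| ≤ B) (hB : 0 < B) (hη : 0 < η) (hγ : B * k * η < 1) :
    ∃ p, (G, p) ∈ designs k S ∧
      ∑ x, ν x * 𝒢.realObjective η q G p x ≤ B * k + B ^ 2 * k ^ 2 / (1 - B * k * η) := by
  classical
  -- The exploration rate for which the uniform part alone gives each action probability `γ / k = B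
  -- * η`; then all arguments `η * G / p` have absolute value at most `1`.
  set γ : ℝ := B * k * η with hγdef
  have hk : (0 : ℝ) < k := by exact_mod_cast r.pos
  have hγ0 : 0 < γ := by positivity
  have hcard : ∀ b, (0 : ℝ) < (P b).card := fun b => by exact_mod_cast (hP b).card_pos
  have hcardk : ∀ b, ((P b).card : ℝ) ≤ k := fun b => by
    have := (P b).card_le_univ
    rw [Fintype.card_fin] at this
    exact_mod_cast this
  set p' : Fin k → ℝ := fun a => ∑ b, if a ∈ P b then q b / (P b).card else 0 with hp'
  have hsw : ∀ f : Fin k → ℝ, ∑ a, p' a * f a = ∑ b, q b / (P b).card * ∑ a ∈ P b, f a := by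
    intro f
    simp only [hp', Finset.sum_mul, Finset.mul_sum]
    rw [Finset.sum_comm]
    refine Finset.sum_congr rfl fun b _ => ?_
    rw [← Finset.sum_filter_add_sum_filter_not Finset.univ (· ∈ P b)]
    rw [Finset.sum_eq_zero (s := Finset.univ.filter (· ∉ P b))
      (fun a ha => by simp [(Finset.mem_filter.1 ha).2]), add_zero]
    rw [Finset.filter_mem_eq_inter, Finset.univ_inter]
    exact Finset.sum_congr rfl fun a ha => by simp [ha]
  have hp'0 : ∀ a, 0 ≤ p' a := fun a => Finset.sum_nonneg fun b _ => by
    split_ifs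
    · exact div_nonneg (hq.1 b) (hcard b).le
    · exact le_rfl
  have hp'1 : ∑ a, p' a = 1 := by
    have := hsw fun _ => 1
    simp only [mul_one, Finset.sum_const, nsmul_eq_mul] at this
    rw [this, ← hq.2]
    exact Finset.sum_congr rfl fun b _ => div_mul_cancel₀ _ (hcard b).ne'
  -- Each `b` whose chain contains `a` sends at least `q b / k` to `a`. This lets `p a` cancel in
  -- the variance, which is then independent of `q`.
  have hp'S : ∀ a, ∑ b, (if a ∈ P b then q b else 0) ≤ k * p' a := by
    intro a
    rw [hp', Finset.mul_sum]
    refine Finset.sum_le_sum fun b _ => ?_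
    split_ifs
    · rw [mul_div_assoc', le_div_iff₀ (hcard b), mul_comm]
      exact mul_le_mul_of_nonneg_right (hcardk b) (hq.1 b)
    · simp
  set p : Fin k → ℝ := fun a => (1 - γ) * p' a + γ / k with hp
  have hp0 : ∀ a, B * η ≤ p a := fun a => by
    have h1 : γ / k = B * η := by rw [hγdef]; field_simp
    have h2 : 0 ≤ (1 - γ) * p' a := mul_nonneg (by linarith) (hp'0 a)
    simp only [hp, h1]
    linarith
  have hBη : 0 < B * η := by positivity
  have hppos : ∀ a, 0 < p a := fun a => hBη.trans_le (hp0 a)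
  have hp1 : ∑ a, p a = 1 := by
    simp only [hp, Finset.sum_add_distrib, ← Finset.mul_sum, hp'1]
    simp only [Finset.sum_const, Finset.card_univ, Fintype.card_fin, nsmul_eq_mul]
    field_simp
    ring
  refine ⟨p, ⟨⟨fun a => (hppos a).le, hp1⟩, hppos⟩, ?_⟩
  -- the linear part
  set M : ℝ := ∑ b, q b * 𝒢.expLoss (base b) ν with hM
  have hM0 : 0 ≤ M := Finset.sum_nonneg fun b _ =>
    mul_nonneg (hq.1 b) (𝒢.expLoss_mem_Icc hν _).1
  -- By `bias_eq_of_estimator` the linear part is the loss of `p` minus that of `q` moved along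
  -- `base`. At `ν` the moved mass costs nothing, so only the exploration `γ` is paid.
  have hlin : ∑ x, ν x * ((∑ a, (p a - q a) * 𝒢.loss a x) + 𝒢.bias q G x) ≤ γ := by
    have h1 : ∀ x, (∑ a, (p a - q a) * 𝒢.loss a x) + 𝒢.bias q G x =
        ∑ a, p a * 𝒢.loss a x - ∑ b, q b * 𝒢.loss (base b) x := by
      intro x
      rw [𝒢.bias_eq_of_estimator hne hq.2 hbase hG, ← Finset.sum_add_distrib,
        ← Finset.sum_sub_distrib]
      exact Finset.sum_congr rfl fun b _ => by ring
    have h2 : ∀ (f : Fin k → ℝ) (g : Fin k → Fin k),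
        ∑ x, ν x * ∑ a, f a * 𝒢.loss (g a) x = ∑ a, f a * 𝒢.expLoss (g a) ν := by
      intro f g
      simp only [expLoss, Finset.mul_sum]
      rw [Finset.sum_comm]
      exact Finset.sum_congr rfl fun a _ => Finset.sum_congr rfl fun x _ => by ring
    simp only [h1, mul_sub, Finset.sum_sub_distrib]
    have h2id : ∑ x, ν x * ∑ a, p a * 𝒢.loss a x = ∑ a, p a * 𝒢.expLoss a ν := h2 p id
    rw [h2id, h2 q base, ← hM]
    have h3 : ∑ a, p' a * 𝒢.expLoss a ν ≤ M := by
      rw [hsw, hM]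
      refine Finset.sum_le_sum fun b _ => ?_
      rw [div_mul_eq_mul_div, div_le_iff₀ (hcard b), mul_assoc]
      refine mul_le_mul_of_nonneg_left ?_ (hq.1 b)
      refine (Finset.sum_le_card_nsmul _ _ _ (hPl b)).trans (le_of_eq ?_)
      rw [nsmul_eq_mul, mul_comm]
    have h4 : ∑ a, p a * 𝒢.expLoss a ν =
        (1 - γ) * ∑ a, p' a * 𝒢.expLoss a ν + γ / k * ∑ a, 𝒢.expLoss a ν := by
      rw [Finset.mul_sum, Finset.mul_sum, ← Finset.sum_add_distrib]
      exact Finset.sum_congr rfl fun a _ => by simp only [hp]; ring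
    have h5 : ∑ a, 𝒢.expLoss a ν ≤ k := by
      refine (Finset.sum_le_card_nsmul _ _ 1 fun a _ => (𝒢.expLoss_mem_Icc hν a).2).trans ?_
      simp
    have h6 : γ / k * ∑ a, 𝒢.expLoss a ν ≤ γ := by
      calc _ ≤ γ / k * k := mul_le_mul_of_nonneg_left h5 (by positivity)
        _ = γ := div_mul_cancel₀ _ hk.ne'
    rw [h4]
    have h7 := mul_le_mul_of_nonneg_left h3 (show 0 ≤ 1 - γ by linarith)
    nlinarith
  -- the stability part
  have hstab : ∀ x, ∑ a, p a * stab q (fun b => η * G a (𝒢.signal a x) b / p a) ≤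
      η ^ 2 * (B ^ 2 * k ^ 2 / (1 - γ)) := by
    intro x
    have h1 : ∀ a, p a * stab q (fun b => η * G a (𝒢.signal a x) b / p a) ≤
        η ^ 2 * (B ^ 2 * k / (1 - γ)) := by
      intro a
      have h2 : stab q (fun b => η * G a (𝒢.signal a x) b / p a) ≤
          ∑ b, (if a ∈ P b then q b else 0) * (η * B / p a) ^ 2 := by
        refine Finset.sum_le_sum fun b _ => ?_
        split_ifs with hab
        · refine mul_le_mul_of_nonneg_left ?_ (hq.1 b)
          have hz : |η * G a (𝒢.signal a x) b / p a| ≤ η * B / p a := by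
            rw [abs_div, abs_mul, abs_of_pos hη, abs_of_pos (hppos a)]
            exact div_le_div_of_nonneg_right
              (mul_le_mul_of_nonneg_left (hGB _ _ _) hη.le) (hppos a).le
          have hz1 : η * B / p a ≤ 1 := by
            rw [div_le_one (hppos a), mul_comm]
            exact hp0 a
          set z := η * G a (𝒢.signal a x) b / p a
          -- For `|z| ≤ 1` the stability function is at most `z ^ 2`.
          have h3 := Real.abs_exp_sub_one_sub_id_le (x := -z) (by rw [abs_neg]; linarith)
          have h4 := le_of_abs_le h3
          have h5 : z ^ 2 ≤ (η * B / p a) ^ 2 := by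
            rw [← sq_abs z]
            exact pow_le_pow_left₀ (abs_nonneg _) hz 2
          nlinarith
        · simp [hG0 b a hab]
      rw [← Finset.sum_mul] at h2
      have h3 : (∑ b, if a ∈ P b then q b else 0) ≤ k * p a / (1 - γ) := by
        rw [le_div_iff₀ (by linarith)]
        have h4 : (1 - γ) * p' a ≤ p a := by
          simp only [hp]
          have : 0 < γ / k := by positivity
          linarith
        calc (∑ b, if a ∈ P b then q b else 0) * (1 - γ) ≤ k * p' a * (1 - γ) :=
              mul_le_mul_of_nonneg_right (hp'S a) (by linarith)
          _ = k * ((1 - γ) * p' a) := by ring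
          _ ≤ k * p a := mul_le_mul_of_nonneg_left h4 hk.le
      have h1γ : 1 - γ ≠ 0 := by linarith
      have hpa := (hppos a).ne'
      calc p a * stab q (fun b => η * G a (𝒢.signal a x) b / p a)
          ≤ p a * (k * p a / (1 - γ) * (η * B / p a) ^ 2) :=
            mul_le_mul_of_nonneg_left (h2.trans (mul_le_mul_of_nonneg_right h3 (sq_nonneg _)))
              (hppos a).le
        _ = η ^ 2 * (B ^ 2 * k / (1 - γ)) := by field_simp
    refine (Finset.sum_le_card_nsmul _ _ _ fun a _ => h1 a).trans (le_of_eq ?_)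
    simp only [Finset.card_univ, Fintype.card_fin, nsmul_eq_mul]
    ring
  have hsplit : ∑ x, ν x * 𝒢.realObjective η q G p x =
      (∑ x, ν x * ((∑ a, (p a - q a) * 𝒢.loss a x) + 𝒢.bias q G x)) / η +
      1 / η ^ 2 * ∑ x, ν x * ∑ a, p a * stab q (fun b => η * G a (𝒢.signal a x) b / p a) := by
    rw [Finset.sum_div, Finset.mul_sum, ← Finset.sum_add_distrib]
    exact Finset.sum_congr rfl fun x _ => by rw [realObjective]; ring
  have hstab' : ∑ x, ν x * ∑ a, p a * stab q (fun b => η * G a (𝒢.signal a x) b / p a) ≤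
      η ^ 2 * (B ^ 2 * k ^ 2 / (1 - γ)) := by
    calc _ ≤ ∑ x, ν x * (η ^ 2 * (B ^ 2 * k ^ 2 / (1 - γ))) :=
          Finset.sum_le_sum fun x _ => mul_le_mul_of_nonneg_left (hstab x) (hν.1 x)
      _ = _ := by rw [← Finset.sum_mul, hν.2, one_mul]
  rw [hsplit]
  have h1 : (∑ x, ν x * ((∑ a, (p a - q a) * 𝒢.loss a x) + 𝒢.bias q G x)) / η ≤ B * k := by
    rw [div_le_iff₀ hη]
    exact hlin
  have h2 : 1 / η ^ 2 * ∑ x, ν x * ∑ a, p a * stab q (fun b => η * G a (𝒢.signal a x) b / p a) ≤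
      B ^ 2 * k ^ 2 / (1 - γ) := by
    calc _ ≤ 1 / η ^ 2 * (η ^ 2 * (B ^ 2 * k ^ 2 / (1 - γ))) :=
          mul_le_mul_of_nonneg_left hstab' (by positivity)
      _ = _ := by field_simp
  exact add_le_add h1 h2

theorem exists_design_expectation_le [Finite S] (hk : 0 < k) (hd : 0 < d)
    (hdup : 𝒢.NoDuplicates) (hloc : 𝒢.LocallyObservable) {η : ℝ} (hη : 0 < η)
    (hηle : η ≤ 1 / (2 * (𝒢.maxSignals : ℝ) * (k : ℝ) ^ 2)) {q : Fin k → ℝ}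
    (hq : q ∈ stdSimplex ℝ (Fin k)) {ν : Fin d → ℝ} (hν : ν ∈ stdSimplex ℝ (Fin d)) :
    ∃ y ∈ designs k S, ∑ x, ν x * 𝒢.realObjective η q y.1 y.2 x ≤
      3 * (𝒢.maxSignals : ℝ) ^ 2 * (k : ℝ) ^ 3 := by
  classical
  obtain ⟨l, r, hr, -, hl, hnb⟩ := 𝒢.exists_rank hk hd hdup hν
  -- Actions that are not Pareto optimal have no chain of their own. Their mass is moved to the root
  -- `r`, which is optimal at `ν`.
  set base : Fin k → Fin k := fun b => if b ∈ 𝒢.pareto then b else r with hbase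
  have hbp : ∀ b, base b ∈ 𝒢.pareto := fun b => by
    simp only [hbase]
    split_ifs with h
    · exact h
    · exact hr
  choose P G hbP hG hG0 hPl hG2 _ hGP using fun b =>
    hloc.exists_estimator 𝒢 l r hnb (base b) (hbp b)
  have hm : (1 : ℝ) ≤ 𝒢.maxSignals := by exact_mod_cast 𝒢.one_le_maxSignals hk hd
  set m : ℝ := (𝒢.maxSignals : ℝ)
  have hk1 : (1 : ℝ) ≤ k := by exact_mod_cast hk
  rw [le_div_iff₀ (by positivity)] at hηle
  have main : ∀ B : ℝ, (∀ b a σ, |G b a σ| ≤ B) → 0 < B → B * k * η < 1 →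
      B * k + B ^ 2 * k ^ 2 / (1 - B * k * η) ≤ 3 * m ^ 2 * (k : ℝ) ^ 3 →
      ∃ y ∈ designs k S, ∑ x, ν x * 𝒢.realObjective η q y.1 y.2 x ≤ 3 * m ^ 2 * (k : ℝ) ^ 3 := by
    intro B hGB hB hγ hle
    obtain ⟨p, hp, hpv⟩ := 𝒢.exists_design_of_estimator ⟨r, hr⟩ hq hν
      (G := fun a σ b => G b a σ) (base := base) (r := r) (P := P) (B := B) (η := η)
      (fun c hc => by simp [hbase, hc]) hG (fun b => ⟨_, hbP b⟩) (fun b a ha σ => hG0 b a ha σ)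
      (fun b a ha => by
        rcases eq_or_ne a (base b) with h | h
        · rw [h]
        · exact hl a _ (hPl b a ha h)) (fun a σ b => hGB b a σ) hB hη hγ
    exact ⟨_, hp, hpv.trans hle⟩
  -- With at most two actions a chain has at most one link, so `B = m` is available; then `γ ≤ 1 /
  -- 2` and `m k + 2 m² k² ≤ 3 m² k³`. With at least three, `B = 2m` gives `γ ≤ 1 / 3` and `2 m k +
  -- 6 m² k² ≤ 8 m² k² ≤ 3 m² k³`.
  rcases le_or_gt k 2 with hk2 | hk2
  · have hk2' : (k : ℝ) ≤ 2 := by exact_mod_cast hk2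
    have hγ : m * k * η ≤ 1 / 2 := by nlinarith [mul_pos (by positivity : 0 < m * k) hη]
    refine main m (fun b a σ => (hGP b a σ).trans ?_) (by linarith) (by linarith) ?_
    · have : ((P b).card : ℝ) ≤ k := by
        have := (P b).card_le_univ
        rw [Fintype.card_fin] at this
        exact_mod_cast this
      exact mul_le_of_le_one_left (by linarith) (by linarith)
    · have h1 : m ^ 2 * k ^ 2 / (1 - m * k * η) ≤ 2 * (m ^ 2 * k ^ 2) := by
        rw [div_le_iff₀ (by linarith)]
        nlinarith [(by positivity : 0 < m ^ 2 * (k : ℝ) ^ 2)]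
      have h2 : m * k ≤ m ^ 2 * k ^ 2 := by nlinarith [one_le_mul_of_one_le_of_one_le hm hk1]
      have h3 : m ^ 2 * (k : ℝ) ^ 2 ≤ m ^ 2 * k ^ 3 :=
        mul_le_mul_of_nonneg_left (pow_le_pow_right₀ hk1 (by norm_num)) (by positivity)
      linarith
  · have hk3 : (3 : ℝ) ≤ k := by exact_mod_cast hk2
    have hγ : 2 * m * k * η ≤ 1 / 3 := by nlinarith [mul_pos (by positivity : 0 < m * k) hη]
    refine main (2 * m) hG2 (by linarith) (by linarith) ?_
    have h1 : (2 * m) ^ 2 * k ^ 2 / (1 - 2 * m * k * η) ≤ 6 * (m ^ 2 * k ^ 2) := by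
      rw [div_le_iff₀ (by linarith)]
      nlinarith [(by positivity : 0 < m ^ 2 * (k : ℝ) ^ 2)]
    have h2 : m * k ≤ m ^ 2 * k ^ 2 := by nlinarith [one_le_mul_of_one_le_of_one_le hm hk1]
    have h3 : 3 * (m ^ 2 * (k : ℝ) ^ 2) ≤ m ^ 2 * k ^ 3 := by
      nlinarith [(by positivity : 0 < m ^ 2 * (k : ℝ) ^ 2)]
    linarith [(by positivity : 0 < m ^ 2 * (k : ℝ) ^ 2)]

/-- Exploration by optimisation: estimation functions and a sampling distribution of full support
whose value is almost as small as claimed. -/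
theorem exists_design_forall_lt [Finite S] (hk : 0 < k) (hd : 0 < d)
    (hdup : 𝒢.NoDuplicates) (hloc : 𝒢.LocallyObservable) {η : ℝ} (hη : 0 < η)
    (hηle : η ≤ 1 / (2 * (𝒢.maxSignals : ℝ) * (k : ℝ) ^ 2)) {q : Fin k → ℝ}
    (hq : q ∈ stdSimplex ℝ (Fin k)) {ε : ℝ} (hε : 0 < ε) :
    ∃ y ∈ designs k S, ∀ x, 𝒢.realObjective η q y.1 y.2 x <
      3 * (𝒢.maxSignals : ℝ) ^ 2 * (k : ℝ) ^ 3 + ε := by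
  have : Nonempty (Fin d) := ⟨⟨0, hd⟩⟩
  obtain ⟨_, r, hr, -⟩ := 𝒢.exists_rank hk hd hdup
    (single_mem_stdSimplex ℝ (⟨0, hd⟩ : Fin d))
  exact exists_forall_lt_of_forall_stdSimplex
    (fun x => 𝒢.convexOn_realObjective ⟨r, hr⟩ hη hq.1 x) hε
    fun ν hν => 𝒢.exists_design_expectation_le hk hd hdup hloc hη hηle hq hν

theorem optStar_le [Finite S] (hk : 0 < k) (hd : 0 < d)
    (hdup : 𝒢.NoDuplicates) (hloc : 𝒢.LocallyObservable) {η : ℝ} (hη : 0 < η)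
    (hηle : η ≤ 1 / (2 * (𝒢.maxSignals : ℝ) * (k : ℝ) ^ 2)) :
    𝒢.optStar η ≤ ((3 * (𝒢.maxSignals : ℝ) ^ 2 * (k : ℝ) ^ 3 : ℝ) : EReal) := by
  refine iSup₂_le fun q hq => EReal.le_of_forall_lt_iff_le.1 fun z hz => ?_
  rw [EReal.coe_lt_coe_iff] at hz
  obtain ⟨y, hy, hyz⟩ := 𝒢.exists_design_forall_lt hk hd hdup hloc hη hηle hq (sub_pos.2 hz)
  refine iInf_le_of_le y.1 (iInf₂_le_of_le y.2 hy.1 (iSup_le fun x => ?_))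
  rw [𝒢.objective_eq_realObjective hy.2, EReal.coe_le_coe_iff]
  linarith [hyz x]

end PMGame

/-! ### Exponential weights and their potential. -/

/-- The exponential weights distribution. -/
noncomputable def expWeights {k : ℕ} (η : ℝ) (s : Fin k → ℝ) (b : Fin k) : ℝ :=
  Real.exp (-(η * s b)) / ∑ c, Real.exp (-(η * s c))

theorem sum_exp_pos {k : ℕ} (hk : 0 < k) (f : Fin k → ℝ) : 0 < ∑ c, Real.exp (f c) :=
  Finset.sum_pos (fun _ _ => Real.exp_pos _) ⟨⟨0, hk⟩, Finset.mem_univ _⟩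

theorem expWeights_mem_stdSimplex {k : ℕ} (hk : 0 < k) (η : ℝ) (s : Fin k → ℝ) :
    expWeights η s ∈ stdSimplex ℝ (Fin k) := by
  have h := sum_exp_pos hk fun c => -(η * s c)
  refine ⟨fun b => div_nonneg (Real.exp_pos _).le h.le, ?_⟩
  simp only [expWeights, ← Finset.sum_div]
  exact div_self h.ne'

/-- The potential of exponential weights, relative to the action `c`. -/
noncomputable def expWeightsPotential {k : ℕ} (η : ℝ) (c : Fin k) (s : Fin k → ℝ) : ℝ :=
  Real.log (∑ b, Real.exp (-(η * s b))) / η + s c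

/-- The sum of exponentials dominates its term at `c`; hence the final potential may be dropped from
the regret bound. -/
theorem expWeightsPotential_nonneg {k : ℕ} {η : ℝ} (hη : 0 < η) (c : Fin k) (s : Fin k → ℝ) :
    0 ≤ expWeightsPotential η c s := by
  have h1 : Real.exp (-(η * s c)) ≤ ∑ b, Real.exp (-(η * s b)) :=
    Finset.single_le_sum (f := fun b => Real.exp (-(η * s b)))
      (fun b _ => (Real.exp_pos _).le) (Finset.mem_univ c)
  have h2 := Real.log_le_log (Real.exp_pos _) h1
  rw [Real.log_exp] at h2
  have h3 : -s c ≤ Real.log (∑ b, Real.exp (-(η * s b))) / η := by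
    rw [le_div_iff₀ hη]; linarith
  unfold expWeightsPotential
  linarith

theorem expWeightsPotential_zero {k : ℕ} (η : ℝ) (c : Fin k) :
    expWeightsPotential η c 0 = Real.log k / η := by
  simp [expWeightsPotential]

/-- The ratio of consecutive normalisers is the mean of `exp (-η g)` under the weights, and `log y ≤
y - 1` turns its logarithm into the stability term. -/
theorem expWeightsPotential_add_sub_le {k : ℕ} {η : ℝ} (hη : 0 < η) (c : Fin k)
    (s g : Fin k → ℝ) :
    expWeightsPotential η c (s + g) - expWeightsPotential η c s ≤
      PMGame.stab (expWeights η s) (fun b => η * g b) / η - ∑ b, expWeights η s b * g b + g c := by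
  have h0 := sum_exp_pos c.pos fun c => -(η * s c)
  have h1 := sum_exp_pos c.pos fun c => -(η * (s + g) c)
  have hq := (expWeights_mem_stdSimplex c.pos η s).2
  have h2 : (∑ b, Real.exp (-(η * (s + g) b))) / ∑ b, Real.exp (-(η * s b)) =
      ∑ b, expWeights η s b * Real.exp (-(η * g b)) := by
    rw [Finset.sum_div]
    refine Finset.sum_congr rfl fun b _ => ?_
    rw [expWeights, div_mul_eq_mul_div, ← Real.exp_add]
    congr 2
    simp only [Pi.add_apply]
    ring
  have h3 : Real.log (∑ b, Real.exp (-(η * (s + g) b))) - Real.log (∑ b, Real.exp (-(η * s b))) ≤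
      PMGame.stab (expWeights η s) (fun b => η * g b) - η * ∑ b, expWeights η s b * g b := by
    rw [← Real.log_div h1.ne' h0.ne']
    refine (Real.log_le_sub_one_of_pos (div_pos h1 h0)).trans (le_of_eq ?_)
    rw [h2, PMGame.stab, Finset.mul_sum, ← Finset.sum_sub_distrib]
    refine (congrArg (_ - ·) hq.symm).trans ?_
    rw [← Finset.sum_sub_distrib]
    exact Finset.sum_congr rfl fun b _ => by ring
  have h4 := div_le_div_of_nonneg_right h3 hη.le
  rw [sub_div, sub_div, mul_div_cancel_left₀ _ hη.ne'] at h4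
  simp only [expWeightsPotential, Pi.add_apply] at h4 ⊢
  linarith

namespace PMGame

variable {k d : ℕ} {S : Type*} (𝒢 : PMGame k d S)

/-- One round of exponential weights with importance weighted estimates. -/
theorem expWeights_round_le {η : ℝ} (hη : 0 < η) (s : Fin k → ℝ) {G : Fin k → S → Fin k → ℝ}
    {p : Fin k → ℝ} (hp : (G, p) ∈ designs k S) {c : Fin k} (hc : c ∈ 𝒢.pareto) (x : Fin d) :
    ∑ a, p a * (𝒢.loss a x - 𝒢.loss c x +
      expWeightsPotential η c (s + fun b => G a (𝒢.signal a x) b / p a)) ≤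
      expWeightsPotential η c s + η * 𝒢.realObjective η (expWeights η s) G p x := by
  set q := expWeights η s with hq
  have h1 : ∀ a, p a * expWeightsPotential η c (s + fun b => G a (𝒢.signal a x) b / p a) ≤
      p a * expWeightsPotential η c s +
        (p a * stab q (fun b => η * G a (𝒢.signal a x) b / p a)) / η -
        ∑ b, q b * G a (𝒢.signal a x) b + G a (𝒢.signal a x) c := by
    intro a
    have hpa := hp.2 a
    have h := mul_le_mul_of_nonneg_left
      (expWeightsPotential_add_sub_le hη c s fun b => G a (𝒢.signal a x) b / p a) hpa.le
    rw [← hq] at h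
    have h2 : p a * ∑ b, q b * (G a (𝒢.signal a x) b / p a) =
        ∑ b, q b * G a (𝒢.signal a x) b := by
      rw [Finset.mul_sum]
      refine Finset.sum_congr rfl fun b _ => ?_
      have := hpa.ne'
      change p a ≠ 0 at this
      field_simp
    have h3 : p a * (G a (𝒢.signal a x) c / p a) = G a (𝒢.signal a x) c :=
      mul_div_cancel₀ _ hpa.ne'
    simp only [mul_div_assoc] at h2 h3 ⊢
    rw [mul_sub, mul_add, mul_sub, h2, h3] at h
    linarith
  -- The supremum in the bias covers the comparator because `c` is Pareto optimal.
  have h2 : (∑ a, G a (𝒢.signal a x) c) - 𝒢.loss c x ≤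
      ⨆ c : 𝒢.pareto, ((∑ a, G a (𝒢.signal a x) c) - 𝒢.loss c x) :=
    le_ciSup (f := fun c : 𝒢.pareto => (∑ a, G a (𝒢.signal a x) c) - 𝒢.loss c x)
      (Set.finite_range _).bddAbove ⟨c, hc⟩
  have h3 := Finset.sum_le_sum fun a (_ : a ∈ Finset.univ) => h1 a
  have hp1 : ∑ a, p a = 1 := hp.1.2
  simp only [Finset.sum_add_distrib, Finset.sum_sub_distrib, ← Finset.sum_mul, ← Finset.sum_div,
    hp1, one_mul] at h3
  rw [Finset.sum_comm] at h3
  have h4 : η * 𝒢.realObjective η q G p x = (∑ a, (p a - q a) * 𝒢.loss a x) + 𝒢.bias q G x +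
      (∑ a, p a * stab q fun b => η * G a (𝒢.signal a x) b / p a) / η := by
    rw [realObjective]
    field_simp
  rw [h4, bias]
  simp only [mul_add, mul_sub, sub_mul, Finset.sum_add_distrib, Finset.sum_sub_distrib,
    ← Finset.sum_mul, hp1, one_mul, Finset.mul_sum] at h3 ⊢
  linarith

/-! ### Expectation over the actions played, and induction over the rounds. -/

/-- The complete history after all rounds. -/
def fullHistory {n : ℕ} (A : Fin n → Fin k) (x : Fin n → Fin d) : List (Fin k × S) :=
  List.ofFn fun s => (A s, 𝒢.signal (A s) (x s))

/-- The expectation of a function of the actions played by a policy. -/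
noncomputable def pathExp (π : Policy k S) {n : ℕ} (x : Fin n → Fin d)
    (F : (Fin n → Fin k) → ℝ) : ℝ :=
  ∑ A : Fin n → Fin k, (∏ t, π.prob (𝒢.history A x t) (A t)) * F A

theorem fullHistory_snoc {n : ℕ} (A : Fin n → Fin k) (a : Fin k) (x : Fin (n + 1) → Fin d) :
    𝒢.fullHistory (Fin.snoc A a : Fin (n + 1) → Fin k) x =
      𝒢.fullHistory A (fun t => x t.castSucc) ++ [(a, 𝒢.signal a (x (Fin.last n)))] := by
  unfold fullHistory
  rw [List.ofFn_succ', List.concat_eq_append]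
  simp only [Fin.snoc_castSucc, Fin.snoc_last]

theorem history_snoc_castSucc {n : ℕ} (A : Fin n → Fin k) (a : Fin k) (x : Fin (n + 1) → Fin d)
    (t : Fin n) :
    𝒢.history (Fin.snoc A a : Fin (n + 1) → Fin k) x t.castSucc =
      𝒢.history A (fun t => x t.castSucc) t := by
  have h : ∀ s : Fin t, (Fin.snoc A a : Fin (n + 1) → Fin k)
      (s.castLE (t.castSucc).isLt.le) = A (s.castLE t.isLt.le) := fun s =>
    Fin.snoc_castSucc (α := fun _ => Fin k) a A (s.castLE t.isLt.le)
  unfold history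
  congr 1
  funext s
  rw [h s]
  rfl

theorem history_snoc_last {n : ℕ} (A : Fin n → Fin k) (a : Fin k) (x : Fin (n + 1) → Fin d) :
    𝒢.history (Fin.snoc A a : Fin (n + 1) → Fin k) x (Fin.last n) =
      𝒢.fullHistory A (fun t => x t.castSucc) := by
  have h : ∀ s : Fin n, (Fin.snoc A a : Fin (n + 1) → Fin k)
      (s.castLE (Fin.last n).isLt.le) = A s := fun s =>
    Fin.snoc_castSucc (α := fun _ => Fin k) a A s
  unfold history fullHistory
  congr 1
  funext s
  rw [h s]
  rfl

/-- The tower property: the last action is sampled given the history of all earlier rounds. -/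
theorem pathExp_succ (π : Policy k S) {n : ℕ} (x : Fin (n + 1) → Fin d)
    (F : (Fin (n + 1) → Fin k) → ℝ) :
    𝒢.pathExp π x F = 𝒢.pathExp π (fun t => x t.castSucc) fun A =>
      ∑ a, π.prob (𝒢.fullHistory A fun t => x t.castSucc) a * F (Fin.snoc A a) := by
  unfold pathExp
  rw [← (Fin.snocEquiv fun _ : Fin (n + 1) => Fin k).sum_comp, Fintype.sum_prod_type,
    Finset.sum_comm]
  refine Finset.sum_congr rfl fun A _ => ?_
  rw [Finset.mul_sum]
  refine Finset.sum_congr rfl fun a _ => ?_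
  change (∏ t, π.prob (𝒢.history (Fin.snoc A a : Fin (n + 1) → Fin k) x t)
    ((Fin.snoc A a : Fin (n + 1) → Fin k) t)) * F (Fin.snoc A a) = _
  rw [Fin.prod_univ_castSucc]
  simp only [history_snoc_castSucc, history_snoc_last, Fin.snoc_castSucc, Fin.snoc_last]
  ring

theorem pathExp_mono (π : Policy k S) {n : ℕ} (x : Fin n → Fin d) {F F' : (Fin n → Fin k) → ℝ}
    (h : ∀ A, F A ≤ F' A) : 𝒢.pathExp π x F ≤ 𝒢.pathExp π x F' :=
  Finset.sum_le_sum fun A _ => mul_le_mul_of_nonneg_left (h A)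
    (Finset.prod_nonneg fun _ _ => (π.prob_mem _).1 _)

theorem pathExp_const (π : Policy k S) {n : ℕ} (x : Fin n → Fin d) (r : ℝ) :
    𝒢.pathExp π x (fun _ => r) = r := by
  induction n with
  | zero => simp [pathExp]
  | succ n ih =>
    rw [pathExp_succ]
    simp only [← Finset.sum_mul, (π.prob_mem _).2, one_mul]
    exact ih _

theorem pathExp_add_const (π : Policy k S) {n : ℕ} (x : Fin n → Fin d)
    (F : (Fin n → Fin k) → ℝ) (r : ℝ) :
    𝒢.pathExp π x (fun A => F A + r) = 𝒢.pathExp π x F + r := by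
  have h := 𝒢.pathExp_const π x r
  unfold pathExp at h ⊢
  simp only [mul_add, Finset.sum_add_distrib]
  rw [h]

theorem expRegret_le_of_forall (π : Policy k S) {n : ℕ} (x : Fin n → Fin d) {r : ℝ}
    (h : ∀ A, 𝒢.regret A x ≤ r) : 𝒢.expRegret π x ≤ r :=
  (𝒢.pathExp_mono π x h).trans (𝒢.pathExp_const π x r).le

/-- The cumulative importance weighted estimates of exponential weights. -/
noncomputable def cumEstimate (η : ℝ)
    (Y : (Fin k → ℝ) → (Fin k → S → Fin k → ℝ) × (Fin k → ℝ)) (h : List (Fin k × S)) :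
    Fin k → ℝ :=
  h.foldl (fun s aσ => s + fun b =>
    (Y (expWeights η s)).1 aσ.1 aσ.2 b / (Y (expWeights η s)).2 aσ.1) 0

/-- Exponential weights, sampling from the given designs. -/
noncomputable def expWeightsPolicy (hk : 0 < k) (η : ℝ)
    (Y : (Fin k → ℝ) → (Fin k → S → Fin k → ℝ) × (Fin k → ℝ))
    (hY : ∀ q ∈ stdSimplex ℝ (Fin k), Y q ∈ designs k S) : Policy k S where
  prob h := (Y (expWeights η (cumEstimate η Y h))).2
  prob_mem _ := (hY _ (expWeights_mem_stdSimplex hk _ _)).1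

/-- The regret against `c` plus the potential starts at `log k / η` and, by `expWeights_round_le`,
gains at most `η * V` in conditional expectation per round. -/
theorem pathExp_expWeightsPolicy_le (hk : 0 < k) {η : ℝ} (hη : 0 < η)
    {Y : (Fin k → ℝ) → (Fin k → S → Fin k → ℝ) × (Fin k → ℝ)}
    (hY : ∀ q ∈ stdSimplex ℝ (Fin k), Y q ∈ designs k S) {V : ℝ}
    (hV : ∀ q ∈ stdSimplex ℝ (Fin k), ∀ x, 𝒢.realObjective η q (Y q).1 (Y q).2 x ≤ V)
    {c : Fin k} (hc : c ∈ 𝒢.pareto) {n : ℕ} (x : Fin n → Fin d) :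
    𝒢.pathExp (expWeightsPolicy hk η Y hY) x (fun A =>
      (∑ t, (𝒢.loss (A t) (x t) - 𝒢.loss c (x t))) +
        expWeightsPotential η c (cumEstimate η Y (𝒢.fullHistory A x))) ≤
      Real.log k / η + n * (η * V) := by
  induction n with
  | zero =>
    simp [pathExp, fullHistory, cumEstimate, expWeightsPotential_zero]
  | succ n ih =>
    rw [pathExp_succ]
    have hstep := ih fun t => x t.castSucc
    have h1 := add_le_add_left hstep (η * V)
    rw [← pathExp_add_const] at h1
    refine (𝒢.pathExp_mono _ _ fun A => ?_).trans (h1.trans (le_of_eq ?_))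
    · set s := cumEstimate η Y (𝒢.fullHistory A fun t => x t.castSucc) with hs
      have hq := expWeights_mem_stdSimplex hk η s
      set y := Y (expWeights η s) with hy
      have hround := 𝒢.expWeights_round_le hη s (G := y.1) (p := y.2) (hY _ hq) hc
        (x (Fin.last n))
      have hVx := mul_le_mul_of_nonneg_left (hV _ hq (x (Fin.last n))) hη.le
      have hcum : ∀ a, cumEstimate η Y
          (𝒢.fullHistory (Fin.snoc A a : Fin (n + 1) → Fin k) x) =
          s + fun b => y.1 a (𝒢.signal a (x (Fin.last n))) b / y.2 a := fun a => by
        rw [fullHistory_snoc, cumEstimate, List.foldl_append]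
        rfl
      have hprob : ∀ a, (expWeightsPolicy hk η Y hY).prob
          (𝒢.fullHistory A fun t => x t.castSucc) a = y.2 a := fun a => rfl
      simp only [hcum, hprob, Fin.sum_univ_castSucc, Fin.snoc_castSucc, Fin.snoc_last]
      have hp1 : ∑ a, y.2 a = 1 := (hY _ hq).1.2
      set R := ∑ t : Fin n, (𝒢.loss (A t) (x t.castSucc) - 𝒢.loss c (x t.castSucc))
      have h2 : ∑ a, y.2 a * (R + (𝒢.loss a (x (Fin.last n)) - 𝒢.loss c (x (Fin.last n))) +
          expWeightsPotential η c
            (s + fun b => y.1 a (𝒢.signal a (x (Fin.last n))) b / y.2 a)) =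
          (∑ a, y.2 a) * R + ∑ a, y.2 a * (𝒢.loss a (x (Fin.last n)) -
            𝒢.loss c (x (Fin.last n)) + expWeightsPotential η c
            (s + fun b => y.1 a (𝒢.signal a (x (Fin.last n))) b / y.2 a)) := by
        rw [Finset.sum_mul, ← Finset.sum_add_distrib]
        exact Finset.sum_congr rfl fun a _ => by ring
      rw [h2, hp1, one_mul]
      linarith
    · push_cast
      ring

/-! ### The regret bound: comparator, approximate designs and tuning. -/

/-- Some Pareto optimal action is best in hindsight. -/
theorem exists_pareto_best (hk : 0 < k) (hd : 0 < d) (hdup : 𝒢.NoDuplicates) {n : ℕ}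
    (hn : 0 < n) (x : Fin n → Fin d) :
    ∃ c ∈ 𝒢.pareto, ∀ a, ∑ t, 𝒢.loss c (x t) ≤ ∑ t, 𝒢.loss a (x t) := by
  have hn' : (0 : ℝ) < n := by exact_mod_cast hn
  -- Being best in hindsight means being optimal at the empirical law of the outcomes.
  have hν : ∑ t, (n : ℝ)⁻¹ • (Pi.single (x t) 1 : Fin d → ℝ) ∈ stdSimplex ℝ (Fin d) := by
    refine (convex_stdSimplex ℝ (Fin d)).sum_mem (fun _ _ => by positivity) ?_
      fun t _ => single_mem_stdSimplex ℝ _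
    simp [hn'.ne']
  obtain ⟨_, r, hr, hbest, -⟩ := 𝒢.exists_rank hk hd hdup hν
  refine ⟨r, hr, fun a => ?_⟩
  have h := hbest a
  simp only [expLoss_eq_dotProduct, dotProduct_sum, dotProduct_smul, dotProduct_single_one,
    ← Finset.smul_sum, smul_eq_mul] at h
  exact le_of_mul_le_mul_left h (by positivity)

theorem regret_le_of_best (hk : 0 < k) {n : ℕ} (A : Fin n → Fin k) (x : Fin n → Fin d)
    {c : Fin k} (hc : ∀ a, ∑ t, 𝒢.loss c (x t) ≤ ∑ t, 𝒢.loss a (x t)) :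
    𝒢.regret A x ≤ ∑ t, (𝒢.loss (A t) (x t) - 𝒢.loss c (x t)) := by
  have : Nonempty (Fin k) := ⟨⟨0, hk⟩⟩
  refine ciSup_le fun a => ?_
  simp only [Finset.sum_sub_distrib]
  linarith [hc a]

theorem regret_le_rounds (hk : 0 < k) {n : ℕ} (A : Fin n → Fin k) (x : Fin n → Fin d) :
    𝒢.regret A x ≤ n := by
  have : Nonempty (Fin k) := ⟨⟨0, hk⟩⟩
  refine ciSup_le fun a => ?_
  refine (Finset.sum_le_card_nsmul _ _ 1 fun t _ => ?_).trans (by simp)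
  linarith [(𝒢.loss_mem (A t) (x t)).2, (𝒢.loss_mem a (x t)).1]

theorem exists_policy_expRegret_le [Finite S] (hk : 0 < k) (hd : 0 < d)
    (hdup : 𝒢.NoDuplicates) (hloc : 𝒢.LocallyObservable) {η : ℝ} (hη : 0 < η)
    (hηle : η ≤ 1 / (2 * (𝒢.maxSignals : ℝ) * (k : ℝ) ^ 2)) {n : ℕ} (hn : 0 < n) {ε : ℝ}
    (hε : 0 < ε) : ∃ π : Policy k S, ∀ x : Fin n → Fin d, 𝒢.expRegret π x ≤
      Real.log k / η + n * (η * (3 * (𝒢.maxSignals : ℝ) ^ 2 * (k : ℝ) ^ 3)) + ε := by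
  have hn' : (0 : ℝ) < n := by exact_mod_cast hn
  have hex : ∀ q : Fin k → ℝ, ∃ y : (Fin k → S → Fin k → ℝ) × (Fin k → ℝ),
      q ∈ stdSimplex ℝ (Fin k) → y ∈ designs k S ∧ ∀ x, 𝒢.realObjective η q y.1 y.2 x <
        3 * (𝒢.maxSignals : ℝ) ^ 2 * (k : ℝ) ^ 3 + ε / (n * η) := by
    intro q
    by_cases hq : q ∈ stdSimplex ℝ (Fin k)
    -- The infimum need not be attained; a slack of `ε / (n η)`, weighted by `η` over `n` rounds,
    -- costs `ε` in total.
    · obtain ⟨y, hy⟩ := 𝒢.exists_design_forall_lt hk hd hdup hloc hη hηle hq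
        (show 0 < ε / (n * η) by positivity)
      exact ⟨y, fun _ => hy⟩
    · exact ⟨0, fun h => absurd h hq⟩
  choose Y hY using hex
  refine ⟨expWeightsPolicy hk η Y fun q hq => (hY q hq).1, fun x => ?_⟩
  -- The comparator depends only on `x`, not on the actions, so the maximum inside the expectation
  -- is harmless.
  obtain ⟨c, hc, hbest⟩ := 𝒢.exists_pareto_best hk hd hdup hn x
  refine (𝒢.pathExp_mono _ x fun A => ?_).trans
    ((𝒢.pathExp_expWeightsPolicy_le hk hη (fun q hq => (hY q hq).1)
      (fun q hq x => ((hY q hq).2 x).le) hc x).trans (le_of_eq ?_))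
  · exact (𝒢.regret_le_of_best hk A x hbest).trans
      (le_add_of_nonneg_right (expWeightsPotential_nonneg hη c _))
  · field_simp
    ring

theorem minimaxRegret_le_of_forall {n : ℕ} {R : ℝ}
    (h : ∀ ε : ℝ, 0 < ε → ∃ π : Policy k S, ∀ x : Fin n → Fin d, 𝒢.expRegret π x ≤ R + ε) :
    𝒢.minimaxRegret n ≤ (R : EReal) := by
  refine EReal.le_of_forall_lt_iff_le.1 fun z hz => ?_
  rw [EReal.coe_lt_coe_iff] at hz
  obtain ⟨π, hπ⟩ := h _ (sub_pos.2 hz)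
  refine iInf_le_of_le π (iSup_le fun x => ?_)
  rw [EReal.coe_le_coe_iff]
  linarith [hπ x]

theorem minimaxRegret_le [Finite S] (hk : 0 < k) (hd : 0 < d)
    (hdup : 𝒢.NoDuplicates) (hloc : 𝒢.LocallyObservable) (n : ℕ) :
    𝒢.minimaxRegret n ≤ ((2 * (k : ℝ) ^ (3 / 2 : ℝ) * (𝒢.maxSignals : ℝ) *
      √(3 * (n : ℝ) * Real.log (k : ℝ)) : ℝ) : EReal) := by
  have hm : (1 : ℝ) ≤ 𝒢.maxSignals := by exact_mod_cast 𝒢.one_le_maxSignals hk hd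
  have hk1 : (1 : ℝ) ≤ k := by exact_mod_cast hk
  have hlog : 0 ≤ Real.log k := Real.log_nonneg hk1
  have hn0 : (0 : ℝ) ≤ n := Nat.cast_nonneg n
  set m : ℝ := (𝒢.maxSignals : ℝ)
  set R : ℝ := 2 * (k : ℝ) ^ (3 / 2 : ℝ) * m * √(3 * n * Real.log k) with hR
  have hR0 : 0 ≤ R := by positivity
  have hRsq : R ^ 2 = 12 * k ^ 3 * m ^ 2 * n * Real.log k := by
    have h1 : ((k : ℝ) ^ (3 / 2 : ℝ)) ^ 2 = (k : ℝ) ^ 3 := by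
      rw [← Real.rpow_natCast, ← Real.rpow_mul (by linarith), ← Real.rpow_natCast]
      norm_num
    rw [hR, mul_pow, mul_pow, mul_pow, h1, Real.sq_sqrt (by positivity)]
    ring
  refine 𝒢.minimaxRegret_le_of_forall fun ε hε => ?_
  have htriv : (∀ (A : Fin n → Fin k) (x : Fin n → Fin d), 𝒢.regret A x ≤ R) →
      ∃ π : Policy k S, ∀ x : Fin n → Fin d, 𝒢.expRegret π x ≤ R + ε := fun h =>
    ⟨⟨fun _ => Pi.single ⟨0, hk⟩ 1, fun _ => single_mem_stdSimplex ℝ _⟩, fun x =>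
      𝒢.expRegret_le_of_forall _ x fun A => (h A x).trans (by linarith)⟩
  rcases (Nat.succ_le_of_lt hk).eq_or_lt with hk' | hk2
  · refine htriv fun A x => le_trans ?_ hR0
    have : Nonempty (Fin k) := ⟨⟨0, hk⟩⟩
    have hsub : ∀ a b : Fin k, a = b := fun a b => Fin.ext (by omega)
    exact ciSup_le fun a => Finset.sum_nonpos fun t _ => by rw [hsub (A t) a, sub_self]
  have hlogpos : 0 < Real.log k := Real.log_pos (by exact_mod_cast hk2)
  -- The threshold is where `n = R`: below it the trivial bound `n` suffices, above it the tuned `η`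
  -- is admissible.
  rcases le_or_gt (n : ℝ) (12 * k ^ 3 * m ^ 2 * Real.log k) with hle | hgt
  · refine htriv fun A x => (𝒢.regret_le_rounds hk A x).trans ?_
    refine (sq_le_sq₀ (by positivity) hR0).1 ?_
    rw [hRsq]
    nlinarith
  have hnpos : (0 : ℝ) < n := lt_of_le_of_lt (by positivity) hgt
  -- This choice balances the two terms `log k / η` and `3 n η m² k³`, each becoming `R / 2`.
  set η : ℝ := 2 * Real.log k / R with hη
  have hRpos : 0 < R := lt_of_le_of_ne hR0 fun h => by
    rw [← h] at hRsq
    have : 0 < 12 * (k : ℝ) ^ 3 * m ^ 2 * n * Real.log k := by positivity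
    linarith
  have hηpos : 0 < η := by positivity
  have hηle : η ≤ 1 / (2 * m * (k : ℝ) ^ 2) := by
    rw [hη, div_le_div_iff₀ hRpos (by positivity), one_mul]
    refine (sq_le_sq₀ (by positivity) hR0).1 ?_
    rw [hRsq]
    have h1 : 12 * k ^ 3 * m ^ 2 * Real.log k * (12 * k ^ 3 * m ^ 2 * Real.log k) ≤
        12 * k ^ 3 * m ^ 2 * Real.log k * n :=
      mul_le_mul_of_nonneg_left hgt.le (by positivity)
    have h2 : (1 : ℝ) * (k ^ 4 * m ^ 2 * Real.log k ^ 2) ≤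
        (k ^ 2 * m ^ 2) * (k ^ 4 * m ^ 2 * Real.log k ^ 2) := by
      refine mul_le_mul_of_nonneg_right ?_ (by positivity)
      nlinarith [one_le_pow₀ hk1 (n := 2), one_le_pow₀ hm (n := 2)]
    nlinarith [(by positivity : 0 ≤ k ^ 4 * m ^ 2 * Real.log k ^ 2)]
  obtain ⟨π, hπ⟩ := 𝒢.exists_policy_expRegret_le hk hd hdup hloc hηpos hηle
    (n := n) (by exact_mod_cast hnpos) hε
  refine ⟨π, fun x => (hπ x).trans (le_of_eq ?_)⟩
  have h1 : Real.log k / η = R / 2 := by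
    rw [hη]; field_simp
  have h2 : n * (η * (3 * m ^ 2 * (k : ℝ) ^ 3)) = R / 2 := by
    rw [hη]
    field_simp
    linarith
  change _ + n * (η * (3 * m ^ 2 * (k : ℝ) ^ 3)) + ε = _
  rw [h1, h2]
  ring

end PMGame

theorem proposition5 {k d : ℕ} (hk : 0 < k) (hd : 0 < d) {S : Type*} [Finite S]
    (𝒢 : PMGame k d S) (hnd : 𝒢.NonDegenerate) (hdup : 𝒢.NoDuplicates)
    (hloc : 𝒢.LocallyObservable) :
    (∀ η : ℝ, 0 < η → η ≤ 1 / (2 * (𝒢.maxSignals : ℝ) * (k : ℝ) ^ 2) →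
      𝒢.optStar η ≤ ((3 * (𝒢.maxSignals : ℝ) ^ 2 * (k : ℝ) ^ 3 : ℝ) : EReal)) ∧
    (∀ n : ℕ, 𝒢.minimaxRegret n ≤
      ((2 * (k : ℝ) ^ (3 / 2 : ℝ) * (𝒢.maxSignals : ℝ) *
        √(3 * (n : ℝ) * Real.log (k : ℝ)) : ℝ) : EReal)) := by
  exact ⟨fun _ hη hηle => 𝒢.optStar_le hk hd hdup hloc hη hηle,
    𝒢.minimaxRegret_le hk hd hdup hloc⟩
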